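/- Let $M>0$ and $a\in\mathbb R$, and consider the Kerr metric in Boyer--Lindquist coordinates $(t,r,\theta,\phi)$, signature $(+,-,-,-)$, $$ds^2=(1-\varPhi)\,dt^2+2\varPhi a\sin^2\theta\,dt\,d\phi-\frac{\Sigma}{\Delta}dr^2-\Sigma\,d\theta^2-\left(r^2+a^2+\varPhi a^2\sin^2\theta\right)\sin^2\theta\,d\phi^2,$$ $\Sigma=r^2+a^2\cos^2\theta$, $\Delta=r^2-2Mr+a^2$, $\varPhi=2Mr/\Sigma$, on the set where $0<\theta<\pi$, $\Sigma\neq0$, $\Delta\neq0$. Let $$\tilde\ell=\tfrac{r^2+a^2}{\Delta}\partial_t+\partial_r+\tfrac a\Delta\partial_\phi,\quad \tilde n=\tfrac{r^2+a^2}{2\Sigma}\partial_t-\tfrac{\Delta}{2\Sigma}\partial_r+\tfrac{a}{2\Sigma}\partial_\phi,\quad \tilde m=\tfrac{1}{\sqrt2\,(r+ia\cos\theta)}\left(ia\sin\theta\,\partial_t+\partial_\theta+\tfrac{i}{\sin\theta}\partial_\phi\right)$$ be the principal null tetrad. Let $C_{abcd}$ be the Weyl tensor, with the curvature convention $(\nabla_a\nabla_b-\nabla_b\nabla_a)V^d=R_{abc}{}^{d}V^c$,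 $R_{abcd}=R_{abc}{}^{e}g_{ed}$, and put $\tilde\Psi_2=C_{abcd}\tilde\ell^a\tilde m^b\bar{\tilde m}{}^c\tilde n^d$. Then $\tilde\Psi_2$ vanishes nowhere, and $-M^{1/3}/(r-ia\cos\theta)$ is a cube root of it; denote this branch by $\tilde\Psi_2^{1/3}$. Let $\lambda\mapsto(t,r,\theta,\phi)(\lambda)$, $\lambda$ in an interval, be an affinely parametrized null geodesic in this set with tangent vector $\ell^a$, and let $(\ell^a,m^a,\bar m^a,n^a)$ be a null tetrad along it ($\ell^a$, $n^a$ real, $\bar m^a$ the complex conjugate of $m^a$, $\ell^an_a=1$, $m^a\bar m_a=-1$, all other contractions zero), with $m^a$ parallel propagated along the geodesic and with the same orientation as $(\tilde\ell^a,\tilde m^a,\bar{\tilde m}{}^a,\tilde n^a)$. Then $$\mathbb K_{(m)}=2\left[(\ell^a\tilde\ell_a)(m^a\tilde n_a)-(\ell^a\tilde m_a)(m^a\bar{\tilde m}_a)\right]\tilde\Psi_2^{-1/3}$$ is constant along the geodesic, and the Weyl scalar $\Psi_0=C_{abcd}\,\ell^am^b\ell^cm^d$, which is the one appearing in the geodesic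 deviation equation, is given along the geodesic by $$\Psi_0=-\frac{3\,M^{5/3}\,\mathbb K_{(m)}^2}{2\,\big(r-ia\cos\theta\big)^5},\qquad r=r(\lambda),\ \theta=\theta(\lambda).$$ -/

import Mathlib

/-!
Lorentzian geometry in one coordinate chart with coordinates `x 0, x 1, x 2, x 3`, the Kerr metric in
Boyer-Lindquist coordinates `(t, r, θ, φ) = (x 0, x 1, x 2, x 3)`, signature `(+,-,-,-)`.
-/

noncomputable section

namespace KerrLensing

/-- Coordinate tuples (points of the chart). -/
abbrev Coord : Type := Fin 4 → ℝ

/-- A metric field: its components `g_{ij}` as functions of the coordinates. -/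
abbrev MetricField : Type := Coord → Matrix (Fin 4) (Fin 4) ℝ

/-- The partial derivative `∂f/∂x^k` at `x`. -/
def partialDeriv (k : Fin 4) (f : Coord → ℝ) (x : Coord) : ℝ :=
  deriv (fun s : ℝ => f (Function.update x k s)) (x k)

/-- Christoffel symbols of the Levi-Civita connection, `christoffel g x d b c = Γ^d_{bc}`. -/
def christoffel (g : MetricField) (x : Coord) (d b c : Fin 4) : ℝ :=
  (1 / 2) * ∑ e : Fin 4, (g x)⁻¹ d e *
    (partialDeriv b (fun y => g y e c) x + partialDeriv c (fun y => g y e b) x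
      - partialDeriv e (fun y => g y b c) x)

/-- Riemann tensor, `riemannUp g x a b c d = R_{abc}^d`, with the convention
`(∇_a ∇_b - ∇_b ∇_a) V^d = R_{abc}^d V^c`. -/
def riemannUp (g : MetricField) (x : Coord) (a b c d : Fin 4) : ℝ :=
  partialDeriv a (fun y => christoffel g y d b c) x
    - partialDeriv b (fun y => christoffel g y d a c) x
    + ∑ e : Fin 4, (christoffel g x d a e * christoffel g x e b c
        - christoffel g x d b e * christoffel g x e a c)

/-- `R_{abcd} = R_{abc}^e g_{ed}`. -/
def riemannDown (g : MetricField) (x : Coord) (a b c d : Fin 4) : ℝ :=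
  ∑ e : Fin 4, riemannUp g x a b c e * g x e d

/-- The Ricci tensor `R_{ac} = R_{abc}^b`. -/
def ricci (g : MetricField) (x : Coord) (a c : Fin 4) : ℝ :=
  ∑ b : Fin 4, riemannUp g x a b c b

/-- The scalar curvature `g^{ac} R_{ac}`. -/
def scalarCurvature (g : MetricField) (x : Coord) : ℝ :=
  ∑ a : Fin 4, ∑ c : Fin 4, (g x)⁻¹ a c * ricci g x a c

/-- The Weyl tensor `C_{abcd}` in dimension four (the trace-free part of `R_{abcd}`). -/
def weyl (g : MetricField) (x : Coord) (a b c d : Fin 4) : ℝ :=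
  riemannDown g x a b c d
    - (1 / 2) * (g x a c * ricci g x b d - g x a d * ricci g x b c
        - g x b c * ricci g x a d + g x b d * ricci g x a c)
    + (scalarCurvature g x / 6) * (g x a c * g x b d - g x a d * g x b c)

/-- The complexification of a real tangent vector. -/
def toC (u : Fin 4 → ℝ) : Fin 4 → ℂ := fun i => (u i : ℂ)

/-- The componentwise complex conjugate of a complex tangent vector. -/
def conjVec (u : Fin 4 → ℂ) : Fin 4 → ℂ := fun i => (starRingEnd ℂ) (u i)

/-- The complex-bilinear contraction `u^a v_a = g_{ab} u^a v^b` at `x`. -/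
def contr (g : MetricField) (x : Coord) (u v : Fin 4 → ℂ) : ℂ :=
  ∑ a : Fin 4, ∑ b : Fin 4, (g x a b : ℂ) * u a * v b

/-- The full contraction `C_{abcd} u^a v^b w^c z^d` of the Weyl tensor at `x`. -/
def weylContr (g : MetricField) (x : Coord) (u v w z : Fin 4 → ℂ) : ℂ :=
  ∑ a : Fin 4, ∑ b : Fin 4, ∑ c : Fin 4, ∑ d : Fin 4,
    (weyl g x a b c d : ℂ) * u a * v b * w c * z d

/-- `Ψ₀ = C_{abcd} ℓ^a m^b ℓ^c m^d`. -/
def psi0 (g : MetricField) (x : Coord) (l m : Fin 4 → ℂ) : ℂ :=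
  weylContr g x l m l m

/-- `Ψ₂ = C_{abcd} ℓ^a m^b m̄^c n^d`. -/
def psi2 (g : MetricField) (x : Coord) (l m n : Fin 4 → ℂ) : ℂ :=
  weylContr g x l m (conjVec m) n

/-- `(ℓ, m, m̄, n)` is a normalized null tetrad at `x`: `ℓ^a n_a = 1`, `m^a m̄_a = -1`, all other
contractions vanish (`ℓ`, `n` are real; the relations not listed are complex conjugates). -/
structure IsNullTetrad (g : MetricField) (x : Coord)
    (l : Fin 4 → ℝ) (m : Fin 4 → ℂ) (n : Fin 4 → ℝ) : Prop where
  l_l : contr g x (toC l) (toC l) = 0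
  n_n : contr g x (toC n) (toC n) = 0
  m_m : contr g x m m = 0
  l_n : contr g x (toC l) (toC n) = 1
  m_mbar : contr g x m (conjVec m) = -1
  l_m : contr g x (toC l) m = 0
  n_m : contr g x (toC n) m = 0

/-- The determinant of the component matrix of the tetrad `(ℓ, m, m̄, n)`. Two tetrads at the same
point have the same orientation (sign of the volume element on them) iff these are positive
multiples of each other; for normalized null tetrads this means that they are equal. -/
def tetradDet (l : Fin 4 → ℝ) (m : Fin 4 → ℂ) (n : Fin 4 → ℝ) : ℂ :=
  Matrix.det (Matrix.of ![toC l, m, conjVec m, toC n])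

/-- On the parameter interval `I`, the curve `γ` has velocity `l` and the vector field `V` along `γ`
is parallel: `dV^d/dλ + Γ^d_{bc} ℓ^b V^c = 0` (one-sided derivatives at end points of `I`). -/
def IsParallelAlong (g : MetricField) (I : Set ℝ) (γ : ℝ → Coord) (l : ℝ → Fin 4 → ℝ)
    (V : ℝ → Fin 4 → ℂ) : Prop :=
  (∀ s ∈ I, HasDerivWithinAt γ (l s) I s) ∧
  ∀ s ∈ I, HasDerivWithinAt V
    (fun d => -∑ b : Fin 4, ∑ c : Fin 4, (christoffel g (γ s) d b c : ℂ) * (l s b : ℂ) * V s c) I s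

/-- `γ` is an affinely parametrized null geodesic on `I` with tangent `l`, carrying the null tetrad
`(l, m, m̄, n)` with `m` (hence `m̄`) parallel propagated. -/
structure IsAdaptedTetrad (g : MetricField) (I : Set ℝ) (γ : ℝ → Coord)
    (l : ℝ → Fin 4 → ℝ) (m : ℝ → Fin 4 → ℂ) (n : ℝ → Fin 4 → ℝ) : Prop where
  geodesic : IsParallelAlong g I γ l (fun s => toC (l s))
  parallel_m : IsParallelAlong g I γ l m
  tetrad : ∀ s ∈ I, IsNullTetrad g (γ s) (l s) (m s) (n s)

/-- `Σ = r² + a² cos² θ`. -/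
def Sig (a : ℝ) (x : Coord) : ℝ := x 1 ^ 2 + a ^ 2 * Real.cos (x 2) ^ 2

/-- `Δ = r² - 2 r M + a²`. -/
def Del (M a : ℝ) (x : Coord) : ℝ := x 1 ^ 2 - 2 * x 1 * M + a ^ 2

/-- `Φ = 2 M r / Σ`. -/
def Phi (M a : ℝ) (x : Coord) : ℝ := 2 * M * x 1 / Sig a x

/-- The Kerr metric in Boyer-Lindquist coordinates. -/
def kerr (M a : ℝ) : MetricField := fun x =>
  !![1 - Phi M a x, 0, 0, Phi M a x * a * Real.sin (x 2) ^ 2;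
     0, -(Sig a x / Del M a x), 0, 0;
     0, 0, -Sig a x, 0;
     Phi M a x * a * Real.sin (x 2) ^ 2, 0, 0,
       -((x 1 ^ 2 + a ^ 2 + Phi M a x * a ^ 2 * Real.sin (x 2) ^ 2) * Real.sin (x 2) ^ 2)]

/-- The domain of regularity of the Boyer-Lindquist coordinates: off the axis, the horizons and the
ring singularity. -/
def kerrChart (M a : ℝ) : Set Coord :=
  {x | 0 < x 2 ∧ x 2 < Real.pi ∧ Sig a x ≠ 0 ∧ Del M a x ≠ 0}

/-- The outgoing principal null vector `ℓ̃`. -/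
def princL (M a : ℝ) (x : Coord) : Fin 4 → ℝ :=
  ![(x 1 ^ 2 + a ^ 2) / Del M a x, 1, 0, a / Del M a x]

/-- The ingoing principal null vector `ñ`. -/
def princN (M a : ℝ) (x : Coord) : Fin 4 → ℝ :=
  ![(x 1 ^ 2 + a ^ 2) / (2 * Sig a x), -(Del M a x / (2 * Sig a x)), 0, a / (2 * Sig a x)]

/-- The complex null vector `m̃`. -/
def princM (a : ℝ) (x : Coord) : Fin 4 → ℂ :=
  let q : ℂ := (Real.sqrt 2 : ℂ) * ((x 1 : ℂ) + Complex.I * a * (Real.cos (x 2) : ℂ))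
  ![Complex.I * a * (Real.sin (x 2) : ℂ) / q, 0, 1 / q, Complex.I / ((Real.sin (x 2) : ℂ) * q)]

/-- `Ψ̃₂`, the Weyl scalar of the Kerr metric in the principal null tetrad. -/
def kerrPsi2 (M a : ℝ) (x : Coord) : ℂ :=
  psi2 (kerr M a) x (toC (princL M a x)) (princM a x) (toC (princN M a x))

/-- `r - i a cos θ`. -/
def zeta (a : ℝ) (x : Coord) : ℂ := (x 1 : ℂ) - Complex.I * a * (Real.cos (x 2) : ℂ)

/-- The cube root `Ψ̃₂^{1/3}`: the branch `-M^{1/3} / (r - i a cos θ)`, continuous on the chart and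
real on the equatorial plane. -/
def kerrPsi2Root (M a : ℝ) (x : Coord) : ℂ := -((M ^ (1 / 3 : ℝ) : ℝ) : ℂ) / zeta a x

/-- The Walker-Penrose quantity
`𝕂_(k) = 2 [(ℓ^a ℓ̃_a)(k^a ñ_a) - (ℓ^a m̃_a)(k^a m̃̄_a)] Ψ̃₂^{-1/3}` of the Kerr metric. -/
def walkerPenrose (M a : ℝ) (x : Coord) (l k : Fin 4 → ℂ) : ℂ :=
  2 * (contr (kerr M a) x l (toC (princL M a x)) * contr (kerr M a) x k (toC (princN M a x))
      - contr (kerr M a) x l (princM a x) * contr (kerr M a) x k (conjVec (princM a x)))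
    * (kerrPsi2Root M a x)⁻¹

end KerrLensing

end

/-! The Kerr metric is a vacuum metric of type D with a hidden symmetry, and one complex two-form
carries all of this. Let ζ = r - i a cos θ, let e⁰, …, e³ be the rows of `coframe`, and put Z =
e⁰∧e¹ - i e²∧e³.

Curvature. R_{ijkl} is the real part of (M/ζ³)(-3 Z_{ij} Z_{kl} - G_{ijkl} - i ε_{ijkl}), where
G_{ijkl} = g_{ik} g_{jl} - g_{il} g_{jk} and ε = e⁰∧e¹∧e²∧e³; `curv` is this expression written out
in real terms (`riemannDown_kerr`). It is trace-free (`ricci_kerr`), hence equal to the Weyl tensor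
(`weyl_kerr`).

Algebra. The orientation hypothesis forces the conjugate of Z to vanish on ℓ∧m
(`cofWedge_two_three_eq`). The term G vanishes there because ℓ is null and orthogonal to m, and ε
vanishes because ℓ∧m is a simple bivector. What survives is Ψ₀ = -(3/2)(M/ζ³) Z(ℓ,m)² (`psi0_eq`).

Conservation. The two-form ζZ is a conformal Killing-Yano tensor: its covariant derivative,
symmetrized in the derivative index and the first form index, consists of metric terms only
(`covDeriv_ckyRe`, `covDeriv_ckyIm`). Along the geodesic, the derivative of ζ Z(ℓ,m) contracts these
terms with ℓ, ℓ, m, which gives zero. Since ℓ and m are orthogonal, 𝕂 = -M^{-1/3} ζ Z(ℓ,m)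
(`walkerPenrose_eq`), so 𝕂 is constant (`walkerPenrose_const`). Inserting Z(ℓ,m) = -M^{1/3} 𝕂/ζ into
Ψ₀ gives the formula. -/

noncomputable section

namespace KerrLensing

section

/-! ### The Kerr metric as a rational function of `r, sin θ, cos θ`

In this section `r`, `S = sin θ`, `C = cos θ`, `σ = Σ` and `δ = Δ` are independent variables, related
by hypotheses where necessary. -/

/-- `Φ` and its partial derivatives. -/
def phi (M r σ : ℝ) : ℝ := 2 * M * r / σ
def phiR (M a r C σ : ℝ) : ℝ := 2 * M * (a ^ 2 * C ^ 2 - r ^ 2) / σ ^ 2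
def phiT (M a r S C σ : ℝ) : ℝ := 4 * M * r * a ^ 2 * C * S / σ ^ 2
def phiRR (M a r C σ : ℝ) : ℝ := 4 * M * r * (r ^ 2 - 3 * a ^ 2 * C ^ 2) / σ ^ 3
def phiRT (M a r S C σ : ℝ) : ℝ := 4 * M * a ^ 2 * C * S * (a ^ 2 * C ^ 2 - 3 * r ^ 2) / σ ^ 3
def phiTT (M a r S C σ : ℝ) : ℝ :=
  4 * M * r * a ^ 2 * ((C ^ 2 - S ^ 2) / σ ^ 2 + 4 * a ^ 2 * C ^ 2 * S ^ 2 / σ ^ 3)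

/-- The metric components. -/
def metric (M a r S σ δ : ℝ) : Matrix (Fin 4) (Fin 4) ℝ :=
  !![1 - phi M r σ, 0, 0, phi M r σ * a * S ^ 2;
     0, -(σ / δ), 0, 0;
     0, 0, -σ, 0;
     phi M r σ * a * S ^ 2, 0, 0, -((r ^ 2 + a ^ 2 + phi M r σ * a ^ 2 * S ^ 2) * S ^ 2)]

/-- The inverse metric. -/
def metricInv (M a r S σ δ : ℝ) : Matrix (Fin 4) (Fin 4) ℝ :=
  !![(r ^ 2 + a ^ 2 + phi M r σ * a ^ 2 * S ^ 2) / δ, 0, 0, phi M r σ * a / δ;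
     0, -(δ / σ), 0, 0;
     0, 0, -(1 / σ), 0;
     phi M r σ * a / δ, 0, 0, -((1 - phi M r σ) / (δ * S ^ 2))]

/-- The partial derivatives `∂_r g_{ij}`. -/
def metricDR (M a r S C σ δ : ℝ) : Matrix (Fin 4) (Fin 4) ℝ :=
  !![-phiR M a r C σ, 0, 0, phiR M a r C σ * a * S ^ 2;
       0, -(2 * r / δ - σ * (2 * r - 2 * M) / δ ^ 2), 0, 0;
       0, 0, -(2 * r), 0;
       phiR M a r C σ * a * S ^ 2, 0, 0, -((2 * r + phiR M a r C σ * a ^ 2 * S ^ 2) * S ^ 2)]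

/-- The partial derivatives `∂_θ g_{ij}`. -/
def metricDT (M a r S C σ δ : ℝ) : Matrix (Fin 4) (Fin 4) ℝ :=
  !![-phiT M a r S C σ, 0, 0, a * (phiT M a r S C σ * S ^ 2 + 2 * phi M r σ * S * C);
       0, 2 * a ^ 2 * C * S / δ, 0, 0;
       0, 0, 2 * a ^ 2 * C * S, 0;
       a * (phiT M a r S C σ * S ^ 2 + 2 * phi M r σ * S * C), 0, 0,
       -(2 * (r ^ 2 + a ^ 2) * S * C
          + a ^ 2 * (phiT M a r S C σ * S ^ 4 + 4 * phi M r σ * S ^ 3 * C))]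

/-- The first partial derivatives of the metric, `metricD k i j = ∂_k g_{ij}`. -/
def metricD (M a r S C σ δ : ℝ) (k i j : Fin 4) : ℝ :=
  ![0, metricDR M a r S C σ δ i j, metricDT M a r S C σ δ i j, 0] k

/-- The mixed second partial derivatives of the metric, `∂_r ∂_θ g_{ij}`. -/
def metricDRT (M a r S C σ δ : ℝ) : Matrix (Fin 4) (Fin 4) ℝ :=
  !![-phiRT M a r S C σ, 0, 0, a * (phiRT M a r S C σ * S ^ 2 + 2 * phiR M a r C σ * S * C);
     0, -(2 * a ^ 2 * C * S * (2 * r - 2 * M) / δ ^ 2), 0, 0;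
     0, 0, 0, 0;
     a * (phiRT M a r S C σ * S ^ 2 + 2 * phiR M a r C σ * S * C), 0, 0,
     -(4 * r * S * C + a ^ 2 * (phiRT M a r S C σ * S ^ 4 + 4 * phiR M a r C σ * S ^ 3 * C))]

/-- The second partial derivatives `∂_r ∂_r g_{ij}`. -/
def metricDRR (M a r S C σ δ : ℝ) : Matrix (Fin 4) (Fin 4) ℝ :=
  !![-phiRR M a r C σ, 0, 0, phiRR M a r C σ * a * S ^ 2;
         0, -(2 / δ - 2 * (2 * r * (2 * r - 2 * M) + σ) / δ ^ 2
              + 2 * σ * (2 * r - 2 * M) ^ 2 / δ ^ 3), 0, 0;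
         0, 0, -2, 0;
         phiRR M a r C σ * a * S ^ 2, 0, 0, -((2 + phiRR M a r C σ * a ^ 2 * S ^ 2) * S ^ 2)]

/-- The second partial derivatives `∂_θ ∂_θ g_{ij}`. -/
def metricDTT (M a r S C σ δ : ℝ) : Matrix (Fin 4) (Fin 4) ℝ :=
  !![-phiTT M a r S C σ, 0, 0,
         a * (phiTT M a r S C σ * S ^ 2 + 4 * phiT M a r S C σ * S * C
            + 2 * phi M r σ * (C ^ 2 - S ^ 2));
         0, 2 * a ^ 2 * (C ^ 2 - S ^ 2) / δ, 0, 0;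
         0, 0, 2 * a ^ 2 * (C ^ 2 - S ^ 2), 0;
         a * (phiTT M a r S C σ * S ^ 2 + 4 * phiT M a r S C σ * S * C
            + 2 * phi M r σ * (C ^ 2 - S ^ 2)), 0, 0,
         -(2 * (r ^ 2 + a ^ 2) * (C ^ 2 - S ^ 2)
            + a ^ 2 * (phiTT M a r S C σ * S ^ 4 + 8 * phiT M a r S C σ * S ^ 3 * C
              + 4 * phi M r σ * (3 * S ^ 2 * C ^ 2 - S ^ 4)))]

/-- The second partial derivatives of the metric, `metricDD k l i j = ∂_k ∂_l g_{ij}`. -/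
def metricDD (M a r S C σ δ : ℝ) (k l i j : Fin 4) : ℝ :=
  !![0, 0, 0, 0;
     0, metricDRR M a r S C σ δ i j, metricDRT M a r S C σ δ i j, 0;
     0, metricDRT M a r S C σ δ i j, metricDTT M a r S C σ δ i j, 0;
     0, 0, 0, 0] k l

/-- The Christoffel symbols `Γ^t_{bc}`. -/
def chrisT (M a r S C σ δ : ℝ) : Matrix (Fin 4) (Fin 4) ℝ :=
  !![0, M * (r ^ 2 + a ^ 2) * (r ^ 2 - a ^ 2 * C ^ 2) / (σ ^ 2 * δ),
       -(2 * M * a ^ 2 * r * S * C / σ ^ 2), 0;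
     M * (r ^ 2 + a ^ 2) * (r ^ 2 - a ^ 2 * C ^ 2) / (σ ^ 2 * δ), 0, 0,
       -(a * M * S ^ 2 * ((r ^ 2 + a ^ 2) * (r ^ 2 - a ^ 2 * C ^ 2) + 2 * r ^ 2 * σ) / (σ ^ 2 * δ));
     -(2 * M * a ^ 2 * r * S * C / σ ^ 2), 0, 0, 2 * a ^ 3 * M * r * S ^ 3 * C / σ ^ 2;
     0, -(a * M * S ^ 2 * ((r ^ 2 + a ^ 2) * (r ^ 2 - a ^ 2 * C ^ 2) + 2 * r ^ 2 * σ) / (σ ^ 2 * δ)),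
       2 * a ^ 3 * M * r * S ^ 3 * C / σ ^ 2, 0]

/-- The Christoffel symbols `Γ^r_{bc}`. -/
def chrisR (M a r S C σ δ : ℝ) : Matrix (Fin 4) (Fin 4) ℝ :=
  !![M * δ * (r ^ 2 - a ^ 2 * C ^ 2) / σ ^ 3, 0, 0,
       -(M * δ * a * S ^ 2 * (r ^ 2 - a ^ 2 * C ^ 2) / σ ^ 3);
     0, r / σ + (M - r) / δ, -(a ^ 2 * S * C / σ), 0;
     0, -(a ^ 2 * S * C / σ), -(r * δ / σ), 0;
     -(M * δ * a * S ^ 2 * (r ^ 2 - a ^ 2 * C ^ 2) / σ ^ 3), 0, 0,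
       -(δ * S ^ 2 / σ * (r - M * a ^ 2 * S ^ 2 * (r ^ 2 - a ^ 2 * C ^ 2) / σ ^ 2))]

/-- The Christoffel symbols `Γ^θ_{bc}`. -/
def chrisH (M a r S C σ δ : ℝ) : Matrix (Fin 4) (Fin 4) ℝ :=
  !![-(2 * M * a ^ 2 * r * S * C / σ ^ 3), 0, 0, 2 * M * a * r * (r ^ 2 + a ^ 2) * S * C / σ ^ 3;
     0, a ^ 2 * S * C / (σ * δ), r / σ, 0;
     0, r / σ, -(a ^ 2 * S * C / σ), 0;
     2 * M * a * r * (r ^ 2 + a ^ 2) * S * C / σ ^ 3, 0, 0,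
       -(S * C / σ * ((r ^ 2 + a ^ 2) + 4 * M * r * a ^ 2 * S ^ 2 / σ + 2 * M * r * a ^ 4 * S ^ 4 / σ ^ 2))]

/-- The Christoffel symbols `Γ^φ_{bc}`. -/
def chrisP (M a r S C σ δ : ℝ) : Matrix (Fin 4) (Fin 4) ℝ :=
  !![0, a * M * (r ^ 2 - a ^ 2 * C ^ 2) / (σ ^ 2 * δ), -(2 * M * a * r * C / (S * σ ^ 2)), 0;
     a * M * (r ^ 2 - a ^ 2 * C ^ 2) / (σ ^ 2 * δ), 0, 0,
       (r * σ ^ 2 + M * (a ^ 4 * S ^ 2 * C ^ 2 - r ^ 2 * (σ + (r ^ 2 + a ^ 2)))) / (σ ^ 2 * δ);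
     -(2 * M * a * r * C / (S * σ ^ 2)), 0, 0,
       C / (S * σ ^ 2) * (σ ^ 2 + 2 * M * r * a ^ 2 * S ^ 2);
     0, (r * σ ^ 2 + M * (a ^ 4 * S ^ 2 * C ^ 2 - r ^ 2 * (σ + (r ^ 2 + a ^ 2)))) / (σ ^ 2 * δ),
       C / (S * σ ^ 2) * (σ ^ 2 + 2 * M * r * a ^ 2 * S ^ 2), 0]

/-- The Christoffel symbols, `chris d b c = Γ^d_{bc}`. -/
def chris (M a r S C σ δ : ℝ) (d b c : Fin 4) : ℝ :=
  ![chrisT M a r S C σ δ b c, chrisR M a r S C σ δ b c, chrisH M a r S C σ δ b c,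
    chrisP M a r S C σ δ b c] d

/-- The Christoffel symbols of the first kind, `chrisDown d b c = Γ_{dbc}`. -/
def chrisDown (M a r S C σ δ : ℝ) (d b c : Fin 4) : ℝ :=
  1 / 2 * (metricD M a r S C σ δ b d c + metricD M a r S C σ δ c d b - metricD M a r S C σ δ d b c)

/-- The coframe `dt - a sin² θ dφ, dr, dθ, sin θ (a dt - (r² + a²) dφ)`. -/
def coframe (a r S : ℝ) : Matrix (Fin 4) (Fin 4) ℝ :=
  !![1, 0, 0, -(a * S ^ 2); 0, 1, 0, 0; 0, 0, 1, 0; a * S, 0, 0, -((r ^ 2 + a ^ 2) * S)]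

/-- The wedge products of the elements of the coframe. -/
def wedge (a r S : ℝ) (i j b c : Fin 4) : ℝ :=
  coframe a r S i b * coframe a r S j c - coframe a r S j b * coframe a r S i c

/-- The curvature tensor `R_{abcd}` in closed form. -/
def curv (M a r S C σ δ : ℝ) (i j k l : Fin 4) : ℝ :=
  M * r * (r ^ 2 - 3 * a ^ 2 * C ^ 2) / σ ^ 3 *
      (-3 * (wedge a r S 0 1 i j * wedge a r S 0 1 k l)
        + 3 * (wedge a r S 2 3 i j * wedge a r S 2 3 k l)
        - (metric M a r S σ δ i k * metric M a r S σ δ j l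
            - metric M a r S σ δ i l * metric M a r S σ δ j k))
    + M * a * C * (3 * r ^ 2 - a ^ 2 * C ^ 2) / σ ^ 3 *
      (-2 * (wedge a r S 0 1 i j * wedge a r S 2 3 k l + wedge a r S 2 3 i j * wedge a r S 0 1 k l)
        - (wedge a r S 0 2 i j * wedge a r S 1 3 k l + wedge a r S 1 3 i j * wedge a r S 0 2 k l)
        + (wedge a r S 0 3 i j * wedge a r S 1 2 k l + wedge a r S 1 2 i j * wedge a r S 0 3 k l))

end

section

variable {M a r S C σ δ : ℝ}

/-! ### Algebraic identities between the components -/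

theorem metric_symm (i j : Fin 4) : metric M a r S σ δ i j = metric M a r S σ δ j i := by
  fin_cases i <;> fin_cases j <;> rfl

theorem metricD_symm (k i j : Fin 4) :
    metricD M a r S C σ δ k i j = metricD M a r S C σ δ k j i := by
  fin_cases k <;> fin_cases i <;> fin_cases j <;> rfl

theorem metricDD_comm (k l i j : Fin 4) :
    metricDD M a r S C σ δ k l i j = metricDD M a r S C σ δ l k i j := by
  fin_cases k <;> fin_cases l <;> rfl

theorem metricDD_symm (k l i j : Fin 4) :
    metricDD M a r S C σ δ k l i j = metricDD M a r S C σ δ k l j i := by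
  have hR : metricDRR M a r S C σ δ i j = metricDRR M a r S C σ δ j i := by
    fin_cases i <;> fin_cases j <;> rfl
  have hT : metricDTT M a r S C σ δ i j = metricDTT M a r S C σ δ j i := by
    fin_cases i <;> fin_cases j <;> rfl
  have hX : metricDRT M a r S C σ δ i j = metricDRT M a r S C σ δ j i := by
    fin_cases i <;> fin_cases j <;> rfl
  simp only [metricDD, hR, hT, hX]

theorem metric_mul_metricInv (hσ : σ = r ^ 2 + a ^ 2 * C ^ 2) (hδ : δ = r ^ 2 - 2 * r * M + a ^ 2)
    (hSC : C ^ 2 = 1 - S ^ 2) (hσ0 : σ ≠ 0) (hδ0 : δ ≠ 0) (hS0 : S ≠ 0) :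
    metric M a r S σ δ * metricInv M a r S σ δ = 1 := by
  -- Expressing Σ through sin² alone makes each entry, once denominators are cleared, a polynomial
  -- identity; the same device recurs in the component computations below.
  rw [hSC] at hσ
  ext i j
  fin_cases i <;> fin_cases j <;>
    simp [Matrix.mul_apply, Fin.sum_univ_four, metric, metricInv, phi] <;>
    field_simp <;> (try rw [hσ]) <;> (try rw [hδ]) <;> ring

-- The tabulated symbols are certified through the linear system that defines them, with the upper
-- index lowered. This avoids the inverse metric; invertibility of g then gives uniqueness in
-- `christoffel_kerr`.
set_option maxHeartbeats 1000000 in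
theorem sum_metric_mul_chris (hσ : σ = r ^ 2 + a ^ 2 * C ^ 2) (hδ : δ = r ^ 2 - 2 * r * M + a ^ 2)
    (hSC : C ^ 2 = 1 - S ^ 2) (hσ0 : σ ≠ 0) (hδ0 : δ ≠ 0) (hS0 : S ≠ 0) (d b c : Fin 4) :
    ∑ e, metric M a r S σ δ d e * chris M a r S C σ δ e b c = chrisDown M a r S C σ δ d b c := by
  rw [hSC] at hσ
  fin_cases d <;> fin_cases b <;> fin_cases c <;>
    simp [Fin.sum_univ_four, metric, chris, chrisT, chrisR, chrisH, chrisP, chrisDown, metricD,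
      metricDR, metricDT, phi, phiR, phiT] <;>
    field_simp <;> (try simp only [hSC, hσ, hδ]) <;> try ring

/-! ### The curvature tensor in closed form. -/

/-- The curvature tensor as an expression in the first and second derivatives of the metric. -/
def curvJet (M a r S C σ δ : ℝ) (i j k l : Fin 4) : ℝ :=
  1 / 2 * (metricDD M a r S C σ δ i j l k + metricDD M a r S C σ δ i k l j
      - metricDD M a r S C σ δ i l j k)
    - 1 / 2 * (metricDD M a r S C σ δ j i l k + metricDD M a r S C σ δ j k l i
      - metricDD M a r S C σ δ j l i k)
    - ∑ f, chrisDown M a r S C σ δ f i l * chris M a r S C σ δ f j k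
    + ∑ f, chrisDown M a r S C σ δ f j l * chris M a r S C σ δ f i k

theorem curvJet_swap_left (i j k l : Fin 4) :
    curvJet M a r S C σ δ j i k l = -curvJet M a r S C σ δ i j k l := by
  unfold curvJet
  ring

/-- Both sides are g_{ef} Γ^e_{ij} Γ^f_{kl}, and g is symmetric. -/
theorem sum_chrisDown_mul_chris_comm
    (h : ∀ d b c, ∑ e, metric M a r S σ δ d e * chris M a r S C σ δ e b c
      = chrisDown M a r S C σ δ d b c) (i j k l : Fin 4) :
    ∑ f, chrisDown M a r S C σ δ f i j * chris M a r S C σ δ f k l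
      = ∑ f, chrisDown M a r S C σ δ f k l * chris M a r S C σ δ f i j := by
  simp only [← h, Finset.sum_mul]
  rw [Finset.sum_comm]
  refine Finset.sum_congr rfl fun e _ => Finset.sum_congr rfl fun f _ => ?_
  rw [metric_symm]
  ring

/-- The second derivatives of g match by their symmetries, and the exchange of k and l swaps the two
quadratic terms. Together with `curvJet_swap_left` this lets `eq_of_antisymm` reduce the comparison
with `curv` to a few components. -/
theorem curvJet_swap_right
    (h : ∀ d b c, ∑ e, metric M a r S σ δ d e * chris M a r S C σ δ e b c
      = chrisDown M a r S C σ δ d b c) (i j k l : Fin 4) :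
    curvJet M a r S C σ δ i j l k = -curvJet M a r S C σ δ i j k l := by
  unfold curvJet
  rw [sum_chrisDown_mul_chris_comm h i k, sum_chrisDown_mul_chris_comm h j k,
    metricDD_comm j i k l, metricDD_comm j i l k, metricDD_symm i j k l, metricDD_symm i l k j,
    metricDD_symm i k j l, metricDD_symm j l k i, metricDD_symm j k i l]
  ring

theorem curv_swap_left (i j k l : Fin 4) :
    curv M a r S C σ δ j i k l = -curv M a r S C σ δ i j k l := by
  unfold curv wedge
  ring

theorem curv_swap_right (i j k l : Fin 4) :
    curv M a r S C σ δ i j l k = -curv M a r S C σ δ i j k l := by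
  unfold curv wedge
  ring

/-- A tensor that is antisymmetric in the first and in the second pair of indices is determined by
the components with increasing indices in both pairs. -/
theorem eq_of_antisymm {A B : Fin 4 → Fin 4 → Fin 4 → Fin 4 → ℝ}
    (hA : ∀ i j k l, A j i k l = -A i j k l) (hA' : ∀ i j k l, A i j l k = -A i j k l)
    (hB : ∀ i j k l, B j i k l = -B i j k l) (hB' : ∀ i j k l, B i j l k = -B i j k l)
    (h : ∀ i j k l, i < j → k < l → A i j k l = B i j k l) (i j k l : Fin 4) :
    A i j k l = B i j k l := by
  have h1 : ∀ i j k l, i < j → A i j k l = B i j k l := by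
    intro i j k l hij
    rcases lt_trichotomy k l with hkl | rfl | hkl
    · exact h i j k l hij hkl
    · linarith [hA' i j k k, hB' i j k k]
    · rw [hA', hB', h i j l k hij hkl]
  rcases lt_trichotomy i j with hij | rfl | hij
  · exact h1 i j k l hij
  · linarith [hA i i k l, hB i i k l]
  · rw [hA, hB, h1 j i k l hij]

set_option maxHeartbeats 4000000 in
theorem curvJet_eq_curv (hσ : σ = r ^ 2 + a ^ 2 * C ^ 2) (hδ : δ = r ^ 2 - 2 * r * M + a ^ 2)
    (hSC : C ^ 2 = 1 - S ^ 2) (hσ0 : σ ≠ 0) (hδ0 : δ ≠ 0) (hS0 : S ≠ 0) (i j k l : Fin 4) :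
    curvJet M a r S C σ δ i j k l = curv M a r S C σ δ i j k l := by
  have h := sum_metric_mul_chris hσ hδ hSC hσ0 hδ0 hS0
  refine eq_of_antisymm curvJet_swap_left (curvJet_swap_right h) curv_swap_left curv_swap_right
    (fun i j k l hij hkl => ?_) i j k l
  rw [hSC] at hσ
  clear h
  -- Six pairs i < j and six pairs k < l leave 36 of the 256 components.
  fin_cases i <;> fin_cases j <;> first | exact absurd hij (by decide) | skip
  all_goals
    fin_cases k <;> fin_cases l <;> first | exact absurd hkl (by decide) | skip
  all_goals
    clear hij hkl
    simp [Fin.sum_univ_four, curvJet, curv, metric, chris, chrisT, chrisR, chrisH, chrisP,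
      chrisDown, metricD, metricDR, metricDT, phi, phiR, phiT, metricDD, metricDRR, metricDRT,
      metricDTT, phiRR, phiRT, phiTT, wedge, coframe]
  all_goals
    field_simp
    (try simp only [hSC, hσ, hδ])
    try ring

end

/-! ### Ricci-flatness and the hidden symmetry. -/

section

variable {M a r S C σ δ : ℝ}

-- This trace of the curvature is the Ricci tensor, so the identity is the vacuum equation.
set_option maxHeartbeats 4000000 in
theorem sum_curv_mul_metricInv (hσ : σ = r ^ 2 + a ^ 2 * C ^ 2)
    (hδ : δ = r ^ 2 - 2 * r * M + a ^ 2)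
    (hSC : C ^ 2 = 1 - S ^ 2) (hσ0 : σ ≠ 0) (hδ0 : δ ≠ 0) (hS0 : S ≠ 0) (i k : Fin 4) :
    ∑ j, ∑ l, curv M a r S C σ δ i j k l * metricInv M a r S σ δ l j = 0 := by
  rw [hSC] at hσ
  fin_cases i <;> fin_cases k <;>
    simp [Fin.sum_univ_four, curv, metric, metricInv, phi, wedge, coframe]
  all_goals
    field_simp
    (try simp only [hSC, hσ, hδ])
    try ring

/-! ### The conformal Killing-Yano tensor -/

/-- The real part of the conformal Killing-Yano tensor
`(r - i a cos θ) (e⁰ ∧ e¹ - i e² ∧ e³)`. -/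
def ckyRe (a r S C : ℝ) : Matrix (Fin 4) (Fin 4) ℝ :=
  !![0, r, a ^ 2 * C * S, 0;
     -r, 0, 0, r * a * S ^ 2;
     -(a ^ 2 * C * S), 0, 0, a * C * (r ^ 2 + a ^ 2) * S;
     0, -(r * a * S ^ 2), -(a * C * (r ^ 2 + a ^ 2) * S), 0]

/-- The negative of the imaginary part of the conformal Killing-Yano tensor. -/
def ckyIm (a r S C : ℝ) : Matrix (Fin 4) (Fin 4) ℝ :=
  !![0, a * C, -(r * a * S), 0;
     -(a * C), 0, 0, a ^ 2 * C * S ^ 2;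
     r * a * S, 0, 0, -(r * (r ^ 2 + a ^ 2) * S);
     0, -(a ^ 2 * C * S ^ 2), r * (r ^ 2 + a ^ 2) * S, 0]

/-- The `r`-derivative of `ckyRe`. -/
def ckyReDR (a r S C : ℝ) : Matrix (Fin 4) (Fin 4) ℝ :=
  !![0, 1, 0, 0;
     -1, 0, 0, a * S ^ 2;
     0, 0, 0, a * C * (2 * r) * S;
     0, -(a * S ^ 2), -(a * C * (2 * r) * S), 0]

/-- The `θ`-derivative of `ckyRe`. -/
def ckyReDT (a r S C : ℝ) : Matrix (Fin 4) (Fin 4) ℝ :=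
  !![0, 0, a ^ 2 * (C ^ 2 - S ^ 2), 0;
     0, 0, 0, 2 * r * a * S * C;
     -(a ^ 2 * (C ^ 2 - S ^ 2)), 0, 0, a * (r ^ 2 + a ^ 2) * (C ^ 2 - S ^ 2);
     0, -(2 * r * a * S * C), -(a * (r ^ 2 + a ^ 2) * (C ^ 2 - S ^ 2)), 0]

/-- The `r`-derivative of `ckyIm`. -/
def ckyImDR (a r S : ℝ) : Matrix (Fin 4) (Fin 4) ℝ :=
  !![0, 0, -(a * S), 0;
     0, 0, 0, 0;
     a * S, 0, 0, -((3 * r ^ 2 + a ^ 2) * S);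
     0, 0, (3 * r ^ 2 + a ^ 2) * S, 0]

/-- The `θ`-derivative of `ckyIm`. -/
def ckyImDT (a r S C : ℝ) : Matrix (Fin 4) (Fin 4) ℝ :=
  !![0, -(a * S), -(r * a * C), 0;
     a * S, 0, 0, a ^ 2 * (2 * S * C ^ 2 - S ^ 3);
     r * a * C, 0, 0, -(r * (r ^ 2 + a ^ 2) * C);
     0, -(a ^ 2 * (2 * S * C ^ 2 - S ^ 3)), r * (r ^ 2 + a ^ 2) * C, 0]

/-- The partial derivatives `∂_k` of `ckyRe`. -/
def ckyReD (a r S C : ℝ) (k i j : Fin 4) : ℝ := ![0, ckyReDR a r S C i j, ckyReDT a r S C i j, 0] k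

/-- The partial derivatives `∂_k` of `ckyIm`. -/
def ckyImD (a r S C : ℝ) (k i j : Fin 4) : ℝ := ![0, ckyImDR a r S i j, ckyImDT a r S C i j, 0] k

/-- Together with `ckyIm_eq` this says that `ckyRe` - i `ckyIm` is ζ (e⁰∧e¹ - i e²∧e³). -/
theorem ckyRe_eq (i j : Fin 4) :
    ckyRe a r S C i j = r * wedge a r S 0 1 i j - a * C * wedge a r S 2 3 i j := by
  fin_cases i <;> fin_cases j <;> simp [ckyRe, wedge, coframe] <;> ring

theorem ckyIm_eq (i j : Fin 4) :
    ckyIm a r S C i j = a * C * wedge a r S 0 1 i j + r * wedge a r S 2 3 i j := by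
  fin_cases i <;> fin_cases j <;> simp [ckyIm, wedge, coframe] <;> ring

/-- The covariant derivative `∇_k h_{ij}` in terms of the components `D` of the partial derivatives
of `h`. -/
def covDeriv (M a r S C σ δ : ℝ) (h : Matrix (Fin 4) (Fin 4) ℝ) (D : Fin 4 → Fin 4 → Fin 4 → ℝ)
    (k i j : Fin 4) : ℝ :=
  D k i j - ∑ d, (chris M a r S C σ δ d k i * h d j + chris M a r S C σ δ d k j * h i d)

-- The conformal Killing-Yano equation. The covector g_{0j} in the trace terms is the Killing field
-- ∂_t with its index lowered.
set_option maxHeartbeats 4000000 in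
theorem covDeriv_ckyRe (hσ : σ = r ^ 2 + a ^ 2 * C ^ 2) (hδ : δ = r ^ 2 - 2 * r * M + a ^ 2)
    (hSC : C ^ 2 = 1 - S ^ 2) (hσ0 : σ ≠ 0) (hδ0 : δ ≠ 0) (hS0 : S ≠ 0) (k i j : Fin 4) :
    covDeriv M a r S C σ δ (ckyRe a r S C) (ckyReD a r S C) k i j
      + covDeriv M a r S C σ δ (ckyRe a r S C) (ckyReD a r S C) i k j
      = 2 * (metric M a r S σ δ k i * metric M a r S σ δ 0 j)
        - metric M a r S σ δ k j * metric M a r S σ δ 0 i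
        - metric M a r S σ δ i j * metric M a r S σ δ 0 k := by
  wlog hki : k ≤ i generalizing k i
  · have := this i k (le_of_not_ge hki)
    rw [metric_symm i k] at this
    linarith
  rw [hSC] at hσ
  fin_cases k <;> fin_cases i <;> first | exact absurd hki (by decide) | skip
  all_goals
    clear hki
    fin_cases j <;>
    simp [Fin.sum_univ_four, covDeriv, ckyRe, ckyReD, ckyReDR, ckyReDT, metric, chris, chrisT,
      chrisR, chrisH, chrisP, phi]
  all_goals
    field_simp
    (try simp only [hSC, hσ, hδ])
    try ring

-- There are no trace terms here: the imaginary part is a genuine Killing-Yano tensor.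
set_option maxHeartbeats 4000000 in
theorem covDeriv_ckyIm (hσ : σ = r ^ 2 + a ^ 2 * C ^ 2) (hδ : δ = r ^ 2 - 2 * r * M + a ^ 2)
    (hSC : C ^ 2 = 1 - S ^ 2) (hσ0 : σ ≠ 0) (hδ0 : δ ≠ 0) (hS0 : S ≠ 0) (k i j : Fin 4) :
    covDeriv M a r S C σ δ (ckyIm a r S C) (ckyImD a r S C) k i j
      + covDeriv M a r S C σ δ (ckyIm a r S C) (ckyImD a r S C) i k j = 0 := by
  wlog hki : k ≤ i generalizing k i
  · have := this i k (le_of_not_ge hki)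
    linarith
  rw [hSC] at hσ
  fin_cases k <;> fin_cases i <;> first | exact absurd hki (by decide) | skip
  all_goals
    clear hki
    fin_cases j <;>
    simp [Fin.sum_univ_four, covDeriv, ckyIm, ckyImD, ckyImDR, ckyImDT, chris, chrisT,
      chrisR, chrisH, chrisP]
  all_goals
    field_simp
    (try simp only [hSC, hσ, hδ])
    try ring

end

section

/-! ### Partial derivatives -/

/-- `D` lists the partial derivatives of `F` at `x`. -/
def HasPartialDerivs (F : Coord → ℝ) (D : Fin 4 → ℝ) (x : Coord) : Prop :=
  ∀ k, HasDerivAt (fun s => F (Function.update x k s)) (D k) (x k)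

theorem HasPartialDerivs.partialDeriv_eq {F : Coord → ℝ} {D : Fin 4 → ℝ} {x : Coord}
    (h : HasPartialDerivs F D x) (k : Fin 4) : partialDeriv k F x = D k := (h k).deriv

/-- Stationarity and axial symmetry: only the r and θ slots of the gradient can be nonzero. -/
theorem hasPartialDerivs_of_r_θ {f : ℝ → ℝ → ℝ} {x : Coord} {d₁ d₂ : ℝ}
    (h₁ : HasDerivAt (fun s => f s (x 2)) d₁ (x 1)) (h₂ : HasDerivAt (fun s => f (x 1) s) d₂ (x 2)) :
    HasPartialDerivs (fun y => f (y 1) (y 2)) ![0, d₁, d₂, 0] x := by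
  intro k
  fin_cases k
  · simpa using hasDerivAt_const (x 0) (f (x 1) (x 2))
  · simpa using h₁
  · simpa using h₂
  · simpa using hasDerivAt_const (x 3) (f (x 1) (x 2))

/-! ### Derivatives of Φ and of the metric components in r and θ. -/

section Scalars

variable {M a r S C t δ : ℝ}

theorem hasDerivAt_phi_r (h : r ^ 2 + a ^ 2 * C ^ 2 ≠ 0) :
    HasDerivAt (fun s => phi M s (s ^ 2 + a ^ 2 * C ^ 2)) (phiR M a r C (r ^ 2 + a ^ 2 * C ^ 2))
      r := by
  unfold phi phiR
  refine HasDerivAt.congr_deriv (((hasDerivAt_id' r).const_mul (2 * M)).fun_div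
    ((hasDerivAt_pow 2 r).add_const _) h) ?_
  field_simp
  ring

theorem hasDerivAt_phiR_r (h : r ^ 2 + a ^ 2 * C ^ 2 ≠ 0) :
    HasDerivAt (fun s => phiR M a s C (s ^ 2 + a ^ 2 * C ^ 2))
      (phiRR M a r C (r ^ 2 + a ^ 2 * C ^ 2)) r := by
  unfold phiR phiRR
  refine HasDerivAt.congr_deriv ((((hasDerivAt_pow 2 r).const_sub _).const_mul (2 * M)).fun_div
    (((hasDerivAt_pow 2 r).add_const _).fun_pow 2) (pow_ne_zero 2 h)) ?_
  field_simp
  ring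

theorem hasDerivAt_phiT_r (h : r ^ 2 + a ^ 2 * C ^ 2 ≠ 0) :
    HasDerivAt (fun s => phiT M a s S C (s ^ 2 + a ^ 2 * C ^ 2))
      (phiRT M a r S C (r ^ 2 + a ^ 2 * C ^ 2)) r := by
  unfold phiT phiRT
  refine HasDerivAt.congr_deriv
    ((((((hasDerivAt_id' r).const_mul (4 * M)).mul_const (a ^ 2)).mul_const C).mul_const S).fun_div
    (((hasDerivAt_pow 2 r).add_const _).fun_pow 2) (pow_ne_zero 2 h)) ?_
  field_simp
  ring

theorem hasDerivAt_sigma_θ : HasDerivAt (fun s => r ^ 2 + a ^ 2 * Real.cos s ^ 2)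
    (-(2 * a ^ 2 * Real.cos t * Real.sin t)) t := by
  refine HasDerivAt.congr_deriv ((((Real.hasDerivAt_cos t).fun_pow 2).const_mul _).const_add _) ?_
  ring

theorem hasDerivAt_phi_θ (h : r ^ 2 + a ^ 2 * Real.cos t ^ 2 ≠ 0) :
    HasDerivAt (fun s => phi M r (r ^ 2 + a ^ 2 * Real.cos s ^ 2))
      (phiT M a r (Real.sin t) (Real.cos t) (r ^ 2 + a ^ 2 * Real.cos t ^ 2)) t := by
  unfold phi phiT
  refine HasDerivAt.congr_deriv ((hasDerivAt_const t _).fun_div hasDerivAt_sigma_θ h) ?_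
  field_simp
  ring

theorem hasDerivAt_phiR_θ (h : r ^ 2 + a ^ 2 * Real.cos t ^ 2 ≠ 0) :
    HasDerivAt (fun s => phiR M a r (Real.cos s) (r ^ 2 + a ^ 2 * Real.cos s ^ 2))
      (phiRT M a r (Real.sin t) (Real.cos t) (r ^ 2 + a ^ 2 * Real.cos t ^ 2)) t := by
  unfold phiR phiRT
  refine HasDerivAt.congr_deriv ((((((Real.hasDerivAt_cos t).fun_pow 2).const_mul _).sub_const
    _).const_mul _).fun_div (hasDerivAt_sigma_θ.fun_pow 2) (pow_ne_zero 2 h)) ?_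
  field_simp
  ring

theorem hasDerivAt_phiT_θ (h : r ^ 2 + a ^ 2 * Real.cos t ^ 2 ≠ 0) :
    HasDerivAt (fun s => phiT M a r (Real.sin s) (Real.cos s) (r ^ 2 + a ^ 2 * Real.cos s ^ 2))
      (phiTT M a r (Real.sin t) (Real.cos t) (r ^ 2 + a ^ 2 * Real.cos t ^ 2)) t := by
  unfold phiT phiTT
  refine HasDerivAt.congr_deriv ((((Real.hasDerivAt_cos t).const_mul _).fun_mul
    (Real.hasDerivAt_sin t)).fun_div (hasDerivAt_sigma_θ.fun_pow 2) (pow_ne_zero 2 h)) ?_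
  field_simp
  ring

theorem hasDerivAt_metric_r (hσ : r ^ 2 + a ^ 2 * C ^ 2 ≠ 0) (hδ : r ^ 2 - 2 * r * M + a ^ 2 ≠ 0)
    (i j : Fin 4) :
    HasDerivAt (fun s => metric M a s S (s ^ 2 + a ^ 2 * C ^ 2)
        (s ^ 2 - 2 * s * M + a ^ 2) i j)
      (metricDR M a r S C (r ^ 2 + a ^ 2 * C ^ 2) (r ^ 2 - 2 * r * M + a ^ 2) i j) r := by
  have h0 := hasDerivAt_phi_r (M := M) hσ
  fin_cases i <;> fin_cases j <;> simp only [metric, metricDR, Fin.reduceFinMk, Fin.zero_eta,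
    Fin.mk_one, Matrix.of_apply, Matrix.cons_val]
  all_goals
    first
    | exact hasDerivAt_const _ _
    | apply HasDerivAt.congr_deriv
      case h =>
        -- The derivative is still a metavariable and is assembled by the rules that apply.
        -- `assumption` precedes the structural rules, so `phi` is differentiated by `h0` as a
        -- whole.
        repeat' first
          | exact hasDerivAt_const _ _ | exact hasDerivAt_id' _ | assumption
          | exact Real.hasDerivAt_sin _ | exact Real.hasDerivAt_cos _ | exact pow_ne_zero 2 hδ
          | with_reducible apply HasDerivAt.fun_neg | with_reducible apply HasDerivAt.fun_add
          | with_reducible apply HasDerivAt.fun_sub | with_reducible apply HasDerivAt.fun_mul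
          | with_reducible apply HasDerivAt.fun_pow | with_reducible apply HasDerivAt.fun_div
      case h' =>
        try field_simp
        try ring

theorem hasDerivAt_metric_θ (hσ : r ^ 2 + a ^ 2 * Real.cos t ^ 2 ≠ 0) (hδ : δ ≠ 0)
    (i j : Fin 4) :
    HasDerivAt (fun s => metric M a r (Real.sin s) (r ^ 2 + a ^ 2 * Real.cos s ^ 2) δ i j)
      (metricDT M a r (Real.sin t) (Real.cos t) (r ^ 2 + a ^ 2 * Real.cos t ^ 2) δ i j) t := by
  have h0 := hasDerivAt_phi_θ (M := M) hσ
  have hs := hasDerivAt_sigma_θ (a := a) (r := r) (t := t)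
  fin_cases i <;> fin_cases j <;> simp only [metric, metricDT, Fin.reduceFinMk, Fin.zero_eta,
    Fin.mk_one, Matrix.of_apply, Matrix.cons_val]
  all_goals
    first
    | exact hasDerivAt_const _ _
    | apply HasDerivAt.congr_deriv
      case h =>
        repeat' first
          | exact hasDerivAt_const _ _ | exact hasDerivAt_id' _ | assumption
          | exact Real.hasDerivAt_sin _ | exact Real.hasDerivAt_cos _ | exact pow_ne_zero 2 hδ
          | with_reducible apply HasDerivAt.fun_neg | with_reducible apply HasDerivAt.fun_add
          | with_reducible apply HasDerivAt.fun_sub | with_reducible apply HasDerivAt.fun_mul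
          | with_reducible apply HasDerivAt.fun_pow | with_reducible apply HasDerivAt.fun_div
      case h' =>
        try field_simp
        try ring

theorem hasDerivAt_metricDR_r (hσ : r ^ 2 + a ^ 2 * C ^ 2 ≠ 0) (hδ : r ^ 2 - 2 * r * M + a ^ 2 ≠ 0)
    (i j : Fin 4) :
    HasDerivAt (fun s => metricDR M a s S C (s ^ 2 + a ^ 2 * C ^ 2)
        (s ^ 2 - 2 * s * M + a ^ 2) i j)
      (metricDRR M a r S C (r ^ 2 + a ^ 2 * C ^ 2) (r ^ 2 - 2 * r * M + a ^ 2) i j) r := by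
  have h0 := hasDerivAt_phi_r (M := M) hσ
  have h1 := hasDerivAt_phiR_r (M := M) hσ
  fin_cases i <;> fin_cases j <;> simp only [metricDR, metricDRR, Fin.reduceFinMk, Fin.zero_eta,
    Fin.mk_one, Matrix.of_apply, Matrix.cons_val]
  all_goals
    first
    | exact hasDerivAt_const _ _
    | apply HasDerivAt.congr_deriv
      case h =>
        repeat' first
          | exact hasDerivAt_const _ _ | exact hasDerivAt_id' _ | assumption
          | exact Real.hasDerivAt_sin _ | exact Real.hasDerivAt_cos _ | exact pow_ne_zero 2 hδ
          | with_reducible apply HasDerivAt.fun_neg | with_reducible apply HasDerivAt.fun_add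
          | with_reducible apply HasDerivAt.fun_sub | with_reducible apply HasDerivAt.fun_mul
          | with_reducible apply HasDerivAt.fun_pow | with_reducible apply HasDerivAt.fun_div
      case h' =>
        -- The remaining identity holds with Δ as a free nonzero symbol, which keeps the
        -- denominators simple.
        generalize r ^ 2 - 2 * r * M + a ^ 2 = d at hδ ⊢
        try field_simp
        try ring

theorem hasDerivAt_metricDR_θ (hσ : r ^ 2 + a ^ 2 * Real.cos t ^ 2 ≠ 0) (hδ : δ ≠ 0)
    (i j : Fin 4) :
    HasDerivAt (fun s => metricDR M a r (Real.sin s) (Real.cos s) (r ^ 2 + a ^ 2 * Real.cos s ^ 2) δ i j)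
      (metricDRT M a r (Real.sin t) (Real.cos t) (r ^ 2 + a ^ 2 * Real.cos t ^ 2) δ i j) t := by
  have h0 := hasDerivAt_phi_θ (M := M) hσ
  have hs := hasDerivAt_sigma_θ (a := a) (r := r) (t := t)
  have h1 := hasDerivAt_phiR_θ (M := M) hσ
  fin_cases i <;> fin_cases j <;> simp only [metricDR, metricDRT, Fin.reduceFinMk, Fin.zero_eta,
    Fin.mk_one, Matrix.of_apply, Matrix.cons_val]
  all_goals
    first
    | exact hasDerivAt_const _ _
    | apply HasDerivAt.congr_deriv
      case h =>
        repeat' first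
          | exact hasDerivAt_const _ _ | exact hasDerivAt_id' _ | assumption
          | exact Real.hasDerivAt_sin _ | exact Real.hasDerivAt_cos _ | exact pow_ne_zero 2 hδ
          | with_reducible apply HasDerivAt.fun_neg | with_reducible apply HasDerivAt.fun_add
          | with_reducible apply HasDerivAt.fun_sub | with_reducible apply HasDerivAt.fun_mul
          | with_reducible apply HasDerivAt.fun_pow | with_reducible apply HasDerivAt.fun_div
      case h' =>
        try field_simp
        try ring

theorem hasDerivAt_metricDT_r (hσ : r ^ 2 + a ^ 2 * C ^ 2 ≠ 0) (hδ : r ^ 2 - 2 * r * M + a ^ 2 ≠ 0)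
    (i j : Fin 4) :
    HasDerivAt (fun s => metricDT M a s S C (s ^ 2 + a ^ 2 * C ^ 2)
        (s ^ 2 - 2 * s * M + a ^ 2) i j)
      (metricDRT M a r S C (r ^ 2 + a ^ 2 * C ^ 2) (r ^ 2 - 2 * r * M + a ^ 2) i j) r := by
  have h0 := hasDerivAt_phi_r (M := M) hσ
  have h1 := hasDerivAt_phiR_r (M := M) hσ
  have h2 := hasDerivAt_phiT_r (M := M) (S := S) hσ
  fin_cases i <;> fin_cases j <;> simp only [metricDT, metricDRT, Fin.reduceFinMk, Fin.zero_eta,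
    Fin.mk_one, Matrix.of_apply, Matrix.cons_val]
  all_goals
    first
    | exact hasDerivAt_const _ _
    | apply HasDerivAt.congr_deriv
      case h =>
        repeat' first
          | exact hasDerivAt_const _ _ | exact hasDerivAt_id' _ | assumption
          | exact Real.hasDerivAt_sin _ | exact Real.hasDerivAt_cos _ | exact pow_ne_zero 2 hδ
          | with_reducible apply HasDerivAt.fun_neg | with_reducible apply HasDerivAt.fun_add
          | with_reducible apply HasDerivAt.fun_sub | with_reducible apply HasDerivAt.fun_mul
          | with_reducible apply HasDerivAt.fun_pow | with_reducible apply HasDerivAt.fun_div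
      case h' =>
        try field_simp
        try ring

theorem hasDerivAt_metricDT_θ (hσ : r ^ 2 + a ^ 2 * Real.cos t ^ 2 ≠ 0) (hδ : δ ≠ 0)
    (i j : Fin 4) :
    HasDerivAt (fun s => metricDT M a r (Real.sin s) (Real.cos s) (r ^ 2 + a ^ 2 * Real.cos s ^ 2) δ i j)
      (metricDTT M a r (Real.sin t) (Real.cos t) (r ^ 2 + a ^ 2 * Real.cos t ^ 2) δ i j) t := by
  have h0 := hasDerivAt_phi_θ (M := M) hσ
  have hs := hasDerivAt_sigma_θ (a := a) (r := r) (t := t)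
  have h1 := hasDerivAt_phiR_θ (M := M) hσ
  have h2 := hasDerivAt_phiT_θ (M := M) hσ
  fin_cases i <;> fin_cases j <;> simp only [metricDT, metricDTT, Fin.reduceFinMk, Fin.zero_eta,
    Fin.mk_one, Matrix.of_apply, Matrix.cons_val]
  all_goals
    first
    | exact hasDerivAt_const _ _
    | apply HasDerivAt.congr_deriv
      case h =>
        repeat' first
          | exact hasDerivAt_const _ _ | exact hasDerivAt_id' _ | assumption
          | exact Real.hasDerivAt_sin _ | exact Real.hasDerivAt_cos _ | exact pow_ne_zero 2 hδ
          | with_reducible apply HasDerivAt.fun_neg | with_reducible apply HasDerivAt.fun_add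
          | with_reducible apply HasDerivAt.fun_sub | with_reducible apply HasDerivAt.fun_mul
          | with_reducible apply HasDerivAt.fun_pow | with_reducible apply HasDerivAt.fun_div
      case h' =>
        try field_simp
        try ring

end Scalars

end

section

/-! ### The curvature of the Kerr metric -/

variable {M a : ℝ} {x : Coord}

/-- The first partial derivatives of the Kerr metric. -/
def kerrD (M a : ℝ) (x : Coord) : Fin 4 → Fin 4 → Fin 4 → ℝ :=
  metricD M a (x 1) (Real.sin (x 2)) (Real.cos (x 2)) (Sig a x) (Del M a x)

/-- The second partial derivatives of the Kerr metric. -/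
def kerrDD (M a : ℝ) (x : Coord) : Fin 4 → Fin 4 → Fin 4 → Fin 4 → ℝ :=
  metricDD M a (x 1) (Real.sin (x 2)) (Real.cos (x 2)) (Sig a x) (Del M a x)

/-- The Christoffel symbols of the Kerr metric. -/
def kerrChris (M a : ℝ) (x : Coord) : Fin 4 → Fin 4 → Fin 4 → ℝ :=
  chris M a (x 1) (Real.sin (x 2)) (Real.cos (x 2)) (Sig a x) (Del M a x)

/-- The Christoffel symbols of the first kind of the Kerr metric. -/
def kerrChrisDown (M a : ℝ) (x : Coord) : Fin 4 → Fin 4 → Fin 4 → ℝ :=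
  chrisDown M a (x 1) (Real.sin (x 2)) (Real.cos (x 2)) (Sig a x) (Del M a x)

/-- The curvature tensor of the Kerr metric. -/
def kerrCurv (M a : ℝ) (x : Coord) : Fin 4 → Fin 4 → Fin 4 → Fin 4 → ℝ :=
  curv M a (x 1) (Real.sin (x 2)) (Real.cos (x 2)) (Sig a x) (Del M a x)

theorem kerr_eq_metric : kerr M a x =
    metric M a (x 1) (Real.sin (x 2)) (Sig a x) (Del M a x) := rfl

theorem sin_ne_zero_of_mem_kerrChart (hx : x ∈ kerrChart M a) : Real.sin (x 2) ≠ 0 :=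
  (Real.sin_pos_of_pos_of_lt_pi hx.1 hx.2.1).ne'

theorem isOpen_kerrChart : IsOpen (kerrChart M a) := by
  have h1 : Continuous fun x : Coord => Sig a x := by unfold Sig; fun_prop
  have h2 : Continuous fun x : Coord => Del M a x := by unfold Del; fun_prop
  exact ((isOpen_lt continuous_const (continuous_apply 2)).inter
    ((isOpen_lt (continuous_apply 2) continuous_const).inter
      ((isOpen_ne_fun h1 continuous_const).inter (isOpen_ne_fun h2 continuous_const))))

/-- The closed forms hold on the chart only. Openness makes them hold near a point along each
coordinate line, which is what differentiating them requires. -/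
theorem eventually_update_mem_kerrChart (hx : x ∈ kerrChart M a) (k : Fin 4) :
    ∀ᶠ s in nhds (x k), Function.update x k s ∈ kerrChart M a := by
  have hc : Continuous fun s : ℝ => Function.update x k s :=
    continuous_const.update k continuous_id
  refine hc.continuousAt.eventually_mem (isOpen_kerrChart.mem_nhds ?_)
  rwa [Function.update_eq_self]

theorem hasPartialDerivs_kerr (hx : x ∈ kerrChart M a) (i j : Fin 4) :
    HasPartialDerivs (fun y => kerr M a y i j) (fun k => kerrD M a x k i j) x :=
  hasPartialDerivs_of_r_θ
    (f := fun r t => metric M a r (Real.sin t) (r ^ 2 + a ^ 2 * Real.cos t ^ 2)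
      (r ^ 2 - 2 * r * M + a ^ 2) i j)
    (hasDerivAt_metric_r hx.2.2.1 hx.2.2.2 i j) (hasDerivAt_metric_θ hx.2.2.1 hx.2.2.2 i j)

theorem hasPartialDerivs_kerrD (hx : x ∈ kerrChart M a) (l i j : Fin 4) :
    HasPartialDerivs (fun y => kerrD M a y l i j) (fun k => kerrDD M a x k l i j) x := by
  have h0 : ∀ D : Fin 4 → ℝ, D = 0 → HasPartialDerivs (fun _ => 0) D x := by
    rintro _ rfl k
    exact hasDerivAt_const _ _
  fin_cases l
  · exact h0 _ (by ext k; fin_cases k <;> rfl)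
  · have h := hasPartialDerivs_of_r_θ
      (f := fun r t => metricDR M a r (Real.sin t) (Real.cos t) (r ^ 2 + a ^ 2 * Real.cos t ^ 2)
        (r ^ 2 - 2 * r * M + a ^ 2) i j)
      (hasDerivAt_metricDR_r hx.2.2.1 hx.2.2.2 i j) (hasDerivAt_metricDR_θ hx.2.2.1 hx.2.2.2 i j)
    convert h using 1
    · rfl
    · exact funext fun k => by fin_cases k <;> rfl
  · have h := hasPartialDerivs_of_r_θ
      (f := fun r t => metricDT M a r (Real.sin t) (Real.cos t) (r ^ 2 + a ^ 2 * Real.cos t ^ 2)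
        (r ^ 2 - 2 * r * M + a ^ 2) i j)
      (hasDerivAt_metricDT_r hx.2.2.1 hx.2.2.2 i j) (hasDerivAt_metricDT_θ hx.2.2.1 hx.2.2.2 i j)
    convert h using 1
    · rfl
    · exact funext fun k => by fin_cases k <;> rfl
  · exact h0 _ (by ext k; fin_cases k <;> rfl)

theorem hasPartialDerivs_kerrChrisDown (hx : x ∈ kerrChart M a) (d b c : Fin 4) :
    HasPartialDerivs (fun y => kerrChrisDown M a y d b c)
      (fun k => 1 / 2 * (kerrDD M a x k b d c + kerrDD M a x k c d b - kerrDD M a x k d b c)) x :=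
  fun k => (((hasPartialDerivs_kerrD hx b d c k).fun_add (hasPartialDerivs_kerrD hx c d b k)).fun_sub
    (hasPartialDerivs_kerrD hx d b c k)).const_mul _

theorem kerr_mul_inv (hx : x ∈ kerrChart M a) : kerr M a x *
    metricInv M a (x 1) (Real.sin (x 2)) (Sig a x) (Del M a x) = 1 :=
  metric_mul_metricInv rfl rfl (Real.cos_sq' _) hx.2.2.1 hx.2.2.2 (sin_ne_zero_of_mem_kerrChart hx)

theorem isUnit_det_kerr (hx : x ∈ kerrChart M a) : IsUnit (kerr M a x).det :=
  Matrix.isUnit_det_of_right_inverse (kerr_mul_inv hx)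

theorem sum_kerr_mul_kerrChris (hx : x ∈ kerrChart M a) (d b c : Fin 4) :
    ∑ e, kerr M a x d e * kerrChris M a x e b c = kerrChrisDown M a x d b c :=
  sum_metric_mul_chris rfl rfl (Real.cos_sq' _) hx.2.2.1 hx.2.2.2
    (sin_ne_zero_of_mem_kerrChart hx) d b c

theorem christoffel_kerr (hx : x ∈ kerrChart M a) (d b c : Fin 4) :
    christoffel (kerr M a) x d b c = kerrChris M a x d b c := by
  have h : (kerr M a x).mulVec (fun e => kerrChris M a x e b c)
      = fun e => kerrChrisDown M a x e b c :=
    funext fun e => sum_kerr_mul_kerrChris hx e b c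
  have h2 : (kerr M a x)⁻¹.mulVec (fun e => kerrChrisDown M a x e b c) d
      = kerrChris M a x d b c := by
    rw [← h, Matrix.mulVec_mulVec, Matrix.nonsing_inv_mul _ (isUnit_det_kerr hx),
      Matrix.one_mulVec]
  rw [← h2, christoffel, Matrix.mulVec, dotProduct, Finset.mul_sum]
  refine Finset.sum_congr rfl fun e _ => ?_
  rw [(hasPartialDerivs_kerr hx e c).partialDeriv_eq, (hasPartialDerivs_kerr hx e b).partialDeriv_eq,
    (hasPartialDerivs_kerr hx b c).partialDeriv_eq, kerrChrisDown, chrisDown]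
  simp only [kerrD]
  ring

/-- Only the existence of these derivatives is needed; `riemannDown_kerr` obtains their relevant
combinations from the lowered symbols. -/
theorem differentiableAt_chris_r {r S C : ℝ} (hσ : r ^ 2 + a ^ 2 * C ^ 2 ≠ 0)
    (hδ : r ^ 2 - 2 * r * M + a ^ 2 ≠ 0) (hS : S ≠ 0) (d b c : Fin 4) :
    DifferentiableAt ℝ (fun s => chris M a s S C (s ^ 2 + a ^ 2 * C ^ 2)
      (s ^ 2 - 2 * s * M + a ^ 2) d b c) r := by
  fin_cases d <;> fin_cases b <;> fin_cases c <;>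
    simp only [chris, chrisT, chrisR, chrisH, chrisP, Fin.reduceFinMk, Fin.zero_eta,
      Fin.mk_one, Matrix.of_apply, Matrix.cons_val] <;>
    fun_prop (disch := simp [hσ, hδ, hS])

theorem differentiableAt_chris_θ {r t δ : ℝ} (hσ : r ^ 2 + a ^ 2 * Real.cos t ^ 2 ≠ 0)
    (hδ : δ ≠ 0) (hS : Real.sin t ≠ 0) (d b c : Fin 4) :
    DifferentiableAt ℝ (fun s => chris M a r (Real.sin s) (Real.cos s)
      (r ^ 2 + a ^ 2 * Real.cos s ^ 2) δ d b c) t := by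
  fin_cases d <;> fin_cases b <;> fin_cases c <;>
    simp only [chris, chrisT, chrisR, chrisH, chrisP, Fin.reduceFinMk, Fin.zero_eta,
      Fin.mk_one, Matrix.of_apply, Matrix.cons_val] <;>
    fun_prop (disch := simp [hσ, hδ, hS])

theorem hasPartialDerivs_kerrChris (hx : x ∈ kerrChart M a) (d b c : Fin 4) :
    HasPartialDerivs (fun y => kerrChris M a y d b c)
      (fun k => partialDeriv k (fun y => christoffel (kerr M a) y d b c) x) x := by
  have hS := sin_ne_zero_of_mem_kerrChart hx
  have h := hasPartialDerivs_of_r_θ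
    (f := fun r t => chris M a r (Real.sin t) (Real.cos t) (r ^ 2 + a ^ 2 * Real.cos t ^ 2)
      (r ^ 2 - 2 * r * M + a ^ 2) d b c)
    (differentiableAt_chris_r hx.2.2.1 hx.2.2.2 hS d b c).hasDerivAt
    (differentiableAt_chris_θ hx.2.2.1 hx.2.2.2 hS d b c).hasDerivAt
  intro k
  refine (h k).congr_deriv ?_
  refine (h k).deriv.symm.trans (Filter.EventuallyEq.deriv_eq ?_)
  filter_upwards [eventually_update_mem_kerrChart hx k] with s hs
  exact (christoffel_kerr hs d b c).symm

/-- The derivatives of Γ^d_{bc} are never written out. Differentiating g_{le} Γ^e_{jk} = Γ_{ljk}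
replaces g ∂Γ by second derivatives of g and products ∂g Γ, which turns R_{ijkl} into `curvJet`. -/
theorem riemannDown_kerr (hx : x ∈ kerrChart M a) (i j k l : Fin 4) :
    riemannDown (kerr M a) x i j k l = kerrCurv M a x i j k l := by
  have hS := sin_ne_zero_of_mem_kerrChart hx
  have hg : ∀ p q, kerr M a x p q = kerr M a x q p := metric_symm
  -- The product rule, with two expressions for the same derivative compared by uniqueness.
  have key : ∀ i j k l, ∑ e, kerr M a x e l *
      partialDeriv i (fun y => christoffel (kerr M a) y e j k) x
      = 1 / 2 * (kerrDD M a x i j l k + kerrDD M a x i k l j - kerrDD M a x i l j k)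
        - ∑ e, kerrD M a x i l e * kerrChris M a x e j k := by
    intro i j k l
    have h1 := HasDerivAt.fun_sum (u := Finset.univ) fun e _ =>
      (hasPartialDerivs_kerr hx l e i).fun_mul (hasPartialDerivs_kerrChris hx e j k i)
    have h2 := (hasPartialDerivs_kerrChrisDown hx l j k i).congr_of_eventuallyEq (f₁ :=
      fun s => ∑ e, kerr M a (Function.update x i s) l e
        * kerrChris M a (Function.update x i s) e j k) (by
      filter_upwards [eventually_update_mem_kerrChart hx i] with s hs
      exact sum_kerr_mul_kerrChris hs l j k)
    have h3 := h1.unique h2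
    simp only [Function.update_eq_self, Finset.sum_add_distrib] at h3
    rw [eq_sub_iff_add_eq', ← h3]
    simp only [hg l]
  have key2 : ∀ i j k l, ∑ e, ∑ f, kerr M a x e l *
      (kerrChris M a x e i f * kerrChris M a x f j k)
      = ∑ f, kerrChrisDown M a x l i f * kerrChris M a x f j k := by
    intro i j k l
    rw [Finset.sum_comm]
    refine Finset.sum_congr rfl fun f _ => ?_
    rw [← sum_kerr_mul_kerrChris hx, Finset.sum_mul]
    refine Finset.sum_congr rfl fun e _ => ?_
    rw [hg]
    ring
  -- Metric compatibility, ∂_i g_{lf} = Γ_{lif} + Γ_{fil}.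
  have key3 : ∀ i l f, kerrChrisDown M a x l i f - kerrD M a x i l f
      = -kerrChrisDown M a x f i l := by
    intro i l f
    simp only [kerrChrisDown, chrisDown, kerrD]
    rw [metricD_symm i f l, metricD_symm l f i, metricD_symm f i l]
    ring
  have key4 : ∀ i j k l, ∑ f, kerrChrisDown M a x f i l * kerrChris M a x f j k
      = ∑ f, kerrD M a x i l f * kerrChris M a x f j k
        - ∑ f, kerrChrisDown M a x l i f * kerrChris M a x f j k := by
    intro i j k l
    rw [← Finset.sum_sub_distrib]
    refine Finset.sum_congr rfl fun f _ => ?_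
    linear_combination kerrChris M a x f j k * key3 i l f
  rw [kerrCurv, ← curvJet_eq_curv (σ := Sig a x) (δ := Del M a x) rfl rfl (Real.cos_sq' _) hx.2.2.1 hx.2.2.2 hS]
  have e1 : riemannDown (kerr M a) x i j k l
      = ∑ e, kerr M a x e l * partialDeriv i (fun y => christoffel (kerr M a) y e j k) x
        - ∑ e, kerr M a x e l * partialDeriv j (fun y => christoffel (kerr M a) y e i k) x
        + ∑ e, ∑ f, kerr M a x e l * (kerrChris M a x e i f * kerrChris M a x f j k)
        - ∑ e, ∑ f, kerr M a x e l * (kerrChris M a x e j f * kerrChris M a x f i k) := by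
    simp only [riemannDown, riemannUp, christoffel_kerr hx, ← Finset.sum_sub_distrib,
      ← Finset.sum_add_distrib, ← Finset.mul_sum]
    refine Finset.sum_congr rfl fun e _ => ?_
    rw [Finset.sum_sub_distrib]
    ring
  rw [e1, key, key, key2, key2]
  have h5 := key4 i j k l
  have h6 := key4 j i k l
  simp only [kerrChrisDown, kerrChris, kerrDD, curvJet] at *
  linarith

theorem riemannUp_kerr (hx : x ∈ kerrChart M a) (i j k l : Fin 4) :
    riemannUp (kerr M a) x i j k l = ∑ e, kerrCurv M a x i j k e *
      metricInv M a (x 1) (Real.sin (x 2)) (Sig a x) (Del M a x) e l := by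
  have h : Matrix.vecMul (riemannUp (kerr M a) x i j k) (kerr M a x) = kerrCurv M a x i j k :=
    funext fun l => riemannDown_kerr hx i j k l
  have h2 : riemannUp (kerr M a) x i j k = Matrix.vecMul (kerrCurv M a x i j k)
      (metricInv M a (x 1) (Real.sin (x 2)) (Sig a x) (Del M a x)) := by
    rw [← h, Matrix.vecMul_vecMul, kerr_mul_inv hx, Matrix.vecMul_one]
  rw [h2]
  rfl

theorem ricci_kerr (hx : x ∈ kerrChart M a) (i k : Fin 4) : ricci (kerr M a) x i k = 0 := by
  simp only [ricci, riemannUp_kerr hx]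
  exact sum_curv_mul_metricInv rfl rfl (Real.cos_sq' _) hx.2.2.1 hx.2.2.2
    (sin_ne_zero_of_mem_kerrChart hx) i k

theorem weyl_kerr (hx : x ∈ kerrChart M a) (i j k l : Fin 4) :
    weyl (kerr M a) x i j k l = kerrCurv M a x i j k l := by
  simp [weyl, scalarCurvature, ricci_kerr hx, riemannDown_kerr hx]

end

section

/-! ### Contractions with vectors -/

variable {M a : ℝ} {x : Coord}

/-- The complex-bilinear value of the `i`-th element of the coframe on a tangent vector. -/
def cof (a : ℝ) (x : Coord) (i : Fin 4) (u : Fin 4 → ℂ) : ℂ :=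
  ∑ b, (coframe a (x 1) (Real.sin (x 2)) i b : ℂ) * u b

/-- The value of the wedge product of two elements of the coframe on two tangent vectors. -/
def cofWedge (a : ℝ) (x : Coord) (i j : Fin 4) (u v : Fin 4 → ℂ) : ℂ :=
  cof a x i u * cof a x j v - cof a x j u * cof a x i v

theorem sum_wedge (i j : Fin 4) (u v : Fin 4 → ℂ) :
    ∑ b, ∑ c, (wedge a (x 1) (Real.sin (x 2)) i j b c : ℂ) * u b * v c
      = cofWedge a x i j u v := by
  simp only [cofWedge, cof, Finset.sum_mul_sum, ← Finset.sum_sub_distrib]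
  refine Finset.sum_congr rfl fun b _ => Finset.sum_congr rfl fun c _ => ?_
  simp only [wedge]
  push_cast
  ring

theorem cof_zero (u : Fin 4 → ℂ) :
    cof a x 0 u = u 0 - a * (Real.sin (x 2) : ℂ) ^ 2 * u 3 := by
  simp [cof, coframe, Fin.sum_univ_four]
  ring

theorem cof_one (u : Fin 4 → ℂ) : cof a x 1 u = u 1 := by
  simp [cof, coframe, Fin.sum_univ_four]

theorem cof_two (u : Fin 4 → ℂ) : cof a x 2 u = u 2 := by
  simp [cof, coframe, Fin.sum_univ_four]

theorem cof_three (u : Fin 4 → ℂ) : cof a x 3 u = a * (Real.sin (x 2) : ℂ) * u 0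
    - ((x 1 : ℂ) ^ 2 + a ^ 2) * (Real.sin (x 2) : ℂ) * u 3 := by
  simp [cof, coframe, Fin.sum_univ_four]
  ring

theorem kerr_symm (i j : Fin 4) : kerr M a x i j = kerr M a x j i := metric_symm i j

theorem contr_comm (u v : Fin 4 → ℂ) :
    contr (kerr M a) x u v = contr (kerr M a) x v u := by
  unfold contr
  rw [Finset.sum_comm]
  refine Finset.sum_congr rfl fun b _ => Finset.sum_congr rfl fun c _ => ?_
  rw [kerr_symm]
  ring

theorem conj_contr (g : MetricField) (u v : Fin 4 → ℂ) :
    (starRingEnd ℂ) (contr g x u v) = contr g x (conjVec u) (conjVec v) := by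
  simp [contr, conjVec]

theorem conjVec_toC (u : Fin 4 → ℝ) : conjVec (toC u) = toC u := by
  ext i
  simp [conjVec, toC]

/-- The Kerr metric in the coframe. -/
theorem contr_kerr (hx : x ∈ kerrChart M a) (u v : Fin 4 → ℂ) :
    contr (kerr M a) x u v = Del M a x / Sig a x * (cof a x 0 u * cof a x 0 v)
      - Sig a x / Del M a x * (cof a x 1 u * cof a x 1 v)
      - Sig a x * (cof a x 2 u * cof a x 2 v) - cof a x 3 u * cof a x 3 v / Sig a x := by
  have hσ : (Sig a x : ℂ) ≠ 0 := by exact_mod_cast hx.2.2.1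
  have hδ : (Del M a x : ℂ) ≠ 0 := by exact_mod_cast hx.2.2.2
  have h1 : (Sig a x : ℂ) = (x 1 : ℂ) ^ 2 + a ^ 2 * (1 - (Real.sin (x 2) : ℂ) ^ 2) := by
    rw [Sig, Real.cos_sq']
    push_cast
    ring
  have h2 : (Del M a x : ℂ) = (x 1 : ℂ) ^ 2 - 2 * x 1 * M + a ^ 2 := by
    rw [Del]
    push_cast
    ring
  simp only [cof_zero, cof_one, cof_two, cof_three]
  simp [contr, Fin.sum_univ_four, kerr, Phi]
  field_simp
  rw [Complex.ofReal_sin] at h1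
  generalize Complex.sin (x 2 : ℂ) = S at *
  rw [h1, h2]
  ring

section Sums

variable (A B : Fin 4 → Fin 4 → ℂ) (u v w z : Fin 4 → ℂ)

theorem sum_mul_12_34 : ∑ i, ∑ j, ∑ k, ∑ l, A i j * B k l * u i * v j * w k * z l
    = (∑ i, ∑ j, A i j * u i * v j) * ∑ k, ∑ l, B k l * w k * z l := by
  simp only [Finset.sum_mul]
  refine Finset.sum_congr rfl fun i _ => Finset.sum_congr rfl fun j _ => ?_
  simp only [Finset.mul_sum]
  refine Finset.sum_congr rfl fun k _ => Finset.sum_congr rfl fun l _ => ?_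
  ring

theorem sum_mul_13_24 : ∑ i, ∑ j, ∑ k, ∑ l, A i k * B j l * u i * v j * w k * z l
    = (∑ i, ∑ k, A i k * u i * w k) * ∑ j, ∑ l, B j l * v j * z l := by
  rw [← sum_mul_12_34]
  refine Finset.sum_congr rfl fun i _ => ?_
  rw [Finset.sum_comm]
  refine Finset.sum_congr rfl fun j _ => Finset.sum_congr rfl fun k _ =>
    Finset.sum_congr rfl fun l _ => ?_
  ring

theorem sum_mul_14_23 : ∑ i, ∑ j, ∑ k, ∑ l, A i l * B j k * u i * v j * w k * z l
    = (∑ i, ∑ l, A i l * u i * z l) * ∑ j, ∑ k, B j k * v j * w k := by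
  rw [← sum_mul_13_24]
  refine Finset.sum_congr rfl fun i _ => Finset.sum_congr rfl fun j _ => ?_
  rw [Finset.sum_comm]
  refine Finset.sum_congr rfl fun k _ => Finset.sum_congr rfl fun l _ => ?_
  ring

end Sums

/-- The Weyl tensor of the Kerr metric in the coframe. -/
theorem weylContr_kerr (hx : x ∈ kerrChart M a) (u v w z : Fin 4 → ℂ) :
    weylContr (kerr M a) x u v w z =
      ((M * x 1 * (x 1 ^ 2 - 3 * a ^ 2 * Real.cos (x 2) ^ 2) / Sig a x ^ 3 : ℝ) : ℂ) *
        (-3 * (cofWedge a x 0 1 u v * cofWedge a x 0 1 w z)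
          + 3 * (cofWedge a x 2 3 u v * cofWedge a x 2 3 w z)
          - (contr (kerr M a) x u w * contr (kerr M a) x v z
            - contr (kerr M a) x u z * contr (kerr M a) x v w))
      + ((M * a * Real.cos (x 2) * (3 * x 1 ^ 2 - a ^ 2 * Real.cos (x 2) ^ 2) / Sig a x ^ 3 : ℝ)
        : ℂ) *
        (-2 * (cofWedge a x 0 1 u v * cofWedge a x 2 3 w z
            + cofWedge a x 2 3 u v * cofWedge a x 0 1 w z)
          - (cofWedge a x 0 2 u v * cofWedge a x 1 3 w z
            + cofWedge a x 1 3 u v * cofWedge a x 0 2 w z)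
          + (cofWedge a x 0 3 u v * cofWedge a x 1 2 w z
            + cofWedge a x 1 2 u v * cofWedge a x 0 3 w z)) := by
  have h1 : contr (kerr M a) x u w * contr (kerr M a) x v z = _ :=
    (sum_mul_13_24 (fun i k => (kerr M a x i k : ℂ)) (fun j l => (kerr M a x j l : ℂ))
      u v w z).symm
  have h2 : contr (kerr M a) x u z * contr (kerr M a) x v w = _ :=
    (sum_mul_14_23 (fun i l => (kerr M a x i l : ℂ)) (fun j k => (kerr M a x j k : ℂ))
      u v w z).symm
  rw [h1, h2]
  simp only [weylContr, weyl_kerr hx, ← sum_wedge, ← sum_mul_12_34]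
  simp only [Finset.mul_sum, ← Finset.sum_add_distrib, ← Finset.sum_sub_distrib]
  refine Finset.sum_congr rfl fun i _ => Finset.sum_congr rfl fun j _ =>
    Finset.sum_congr rfl fun k _ => Finset.sum_congr rfl fun l _ => ?_
  simp only [kerrCurv, curv, ← kerr_eq_metric]
  push_cast
  ring

/-! ### The principal null tetrad -/

theorem zeta_mul_conj : zeta a x * ((x 1 : ℂ) + Complex.I * a * (Real.cos (x 2) : ℂ))
    = Sig a x := by
  simp only [zeta, Sig]
  push_cast
  linear_combination -(a : ℂ) ^ 2 * Complex.cos (x 2) ^ 2 * Complex.I_sq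

theorem zeta_ne_zero (hx : x ∈ kerrChart M a) : zeta a x ≠ 0 := by
  intro h
  have := zeta_mul_conj (a := a) (x := x)
  rw [h, zero_mul] at this
  exact hx.2.2.1 (by exact_mod_cast this.symm)

/-- The prefactor is rewritten with ζ in the numerator and the real function Σ below, so that m̃ and
its conjugate involve only ζ and real quantities. -/
theorem princM_eq (hx : x ∈ kerrChart M a) : princM a x =
    fun i => zeta a x / ((Real.sqrt 2 : ℂ) * Sig a x) *
      ![Complex.I * a * (Real.sin (x 2) : ℂ), 0, 1, Complex.I / (Real.sin (x 2) : ℂ)] i := by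
  have h0 := zeta_ne_zero hx
  have hσ : (Sig a x : ℂ) ≠ 0 := by exact_mod_cast hx.2.2.1
  have hs : (Real.sqrt 2 : ℂ) ≠ 0 := by simp
  have hS : (Real.sin (x 2) : ℂ) ≠ 0 := by exact_mod_cast sin_ne_zero_of_mem_kerrChart hx
  have hq : (x 1 : ℂ) + Complex.I * a * (Real.cos (x 2) : ℂ) ≠ 0 := by
    intro h
    have := zeta_mul_conj (a := a) (x := x)
    rw [h, mul_zero] at this
    exact hσ this.symm
  have h : zeta a x / ((Real.sqrt 2 : ℂ) * Sig a x)
      = 1 / ((Real.sqrt 2 : ℂ) * ((x 1 : ℂ) + Complex.I * a * (Real.cos (x 2) : ℂ))) := by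
    rw [← zeta_mul_conj]
    field_simp
  rw [h]
  ext i
  fin_cases i <;> simp only [princM, Fin.reduceFinMk, Fin.zero_eta, Fin.mk_one, Matrix.cons_val] <;>
    first | (field_simp; done) | simp

end

section

variable {M a : ℝ} {x : Coord}

/-- The tetrad is adapted to the coframe: e² and e³ annihilate ℓ̃ and ñ, while e⁰ and e¹ annihilate
m̃. -/
theorem cof_princL (hx : x ∈ kerrChart M a) (i : Fin 4) :
    cof a x i (toC (princL M a x)) = ![(Sig a x / Del M a x : ℂ), 1, 0, 0] i := by
  have hδ : (Del M a x : ℂ) ≠ 0 := by exact_mod_cast hx.2.2.2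
  have h1 : (Sig a x : ℂ) = (x 1 : ℂ) ^ 2 + a ^ 2 * (1 - (Real.sin (x 2) : ℂ) ^ 2) := by
    rw [Sig, Real.cos_sq']
    push_cast
    ring
  fin_cases i <;>
    simp only [Fin.reduceFinMk, Fin.zero_eta, Fin.mk_one, cof_zero, cof_one, cof_two, cof_three,
      toC, princL, Matrix.cons_val] <;> push_cast
  · rw [h1]
    push_cast
    field_simp
    ring
  · rfl
  · rfl
  · field_simp
    ring

theorem cof_princN (hx : x ∈ kerrChart M a) (i : Fin 4) :
    cof a x i (toC (princN M a x)) = ![(1 / 2 : ℂ), -(Del M a x / (2 * Sig a x)), 0, 0] i := by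
  have hσ : (Sig a x : ℂ) ≠ 0 := by exact_mod_cast hx.2.2.1
  have h1 : (Sig a x : ℂ) = (x 1 : ℂ) ^ 2 + a ^ 2 * (1 - (Real.sin (x 2) : ℂ) ^ 2) := by
    rw [Sig, Real.cos_sq']
    push_cast
    ring
  fin_cases i <;>
    simp only [Fin.reduceFinMk, Fin.zero_eta, Fin.mk_one, cof_zero, cof_one, cof_two, cof_three,
      toC, princN, Matrix.cons_val] <;> push_cast
  · rw [Complex.ofReal_sin] at h1
    field_simp
    rw [h1]
    ring
  · rfl
  · rfl
  · field_simp
    ring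

theorem cof_princM (hx : x ∈ kerrChart M a) (i : Fin 4) :
    cof a x i (princM a x) = zeta a x / ((Real.sqrt 2 : ℂ) * Sig a x)
      * ![0, 0, 1, -(Complex.I * Sig a x)] i := by
  have h1 : (Sig a x : ℂ) = (x 1 : ℂ) ^ 2 + a ^ 2 * (1 - (Real.sin (x 2) : ℂ) ^ 2) := by
    rw [Sig, Real.cos_sq']
    push_cast
    ring
  have hS : (Real.sin (x 2) : ℂ) ≠ 0 := by exact_mod_cast sin_ne_zero_of_mem_kerrChart hx
  rw [princM_eq hx]
  generalize zeta a x / ((Real.sqrt 2 : ℂ) * Sig a x) = c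
  fin_cases i <;>
    simp only [Fin.reduceFinMk, Fin.zero_eta, Fin.mk_one, cof_zero, cof_one, cof_two, cof_three,
      Matrix.cons_val] <;>
    generalize (Real.sin (x 2) : ℂ) = S at *
  · field_simp
    ring
  · rw [h1]
    field_simp
    ring

theorem cof_conjVec (i : Fin 4) (u : Fin 4 → ℂ) :
    cof a x i (conjVec u) = (starRingEnd ℂ) (cof a x i u) := by
  simp [cof, conjVec]

theorem conj_zeta_mul (hx : x ∈ kerrChart M a) :
    (starRingEnd ℂ) (zeta a x / ((Real.sqrt 2 : ℂ) * Sig a x)) = 1 / ((Real.sqrt 2 : ℂ) * zeta a x) := by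
  have hσ : (Sig a x : ℂ) ≠ 0 := by exact_mod_cast hx.2.2.1
  have h0 := zeta_ne_zero hx
  have hs : (Real.sqrt 2 : ℂ) ≠ 0 := by simp
  have h : (starRingEnd ℂ) (zeta a x) = (x 1 : ℂ) + Complex.I * a * (Real.cos (x 2) : ℂ) := by
    simp [zeta, -Complex.ofReal_cos]
  rw [map_div₀, map_mul, h, Complex.conj_ofReal, Complex.conj_ofReal]
  field_simp
  rw [← zeta_mul_conj]
  ring

theorem cof_conj_princM (hx : x ∈ kerrChart M a) (i : Fin 4) :
    cof a x i (conjVec (princM a x)) = 1 / ((Real.sqrt 2 : ℂ) * zeta a x)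
      * ![0, 0, 1, Complex.I * Sig a x] i := by
  rw [cof_conjVec, cof_princM hx, map_mul, conj_zeta_mul hx]
  congr 1
  fin_cases i <;> simp

theorem ofReal_sqrt_two_sq : (Real.sqrt 2 : ℂ) ^ 2 = 2 := by
  norm_cast
  simp

theorem contr_princL (hx : x ∈ kerrChart M a) (u : Fin 4 → ℂ) :
    contr (kerr M a) x u (toC (princL M a x))
      = cof a x 0 u - Sig a x / Del M a x * cof a x 1 u := by
  have hσ : (Sig a x : ℂ) ≠ 0 := by exact_mod_cast hx.2.2.1
  have hδ : (Del M a x : ℂ) ≠ 0 := by exact_mod_cast hx.2.2.2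
  simp only [contr_kerr hx, cof_princL hx, Matrix.cons_val]
  field_simp
  ring

theorem contr_princN (hx : x ∈ kerrChart M a) (u : Fin 4 → ℂ) :
    contr (kerr M a) x u (toC (princN M a x))
      = Del M a x / (2 * Sig a x) * cof a x 0 u + 1 / 2 * cof a x 1 u := by
  have hσ : (Sig a x : ℂ) ≠ 0 := by exact_mod_cast hx.2.2.1
  have hδ : (Del M a x : ℂ) ≠ 0 := by exact_mod_cast hx.2.2.2
  simp only [contr_kerr hx, cof_princN hx, Matrix.cons_val]
  field_simp
  ring

theorem contr_princM (hx : x ∈ kerrChart M a) (u : Fin 4 → ℂ) :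
    contr (kerr M a) x u (princM a x) = zeta a x / ((Real.sqrt 2 : ℂ) * Sig a x)
      * (-(Sig a x * cof a x 2 u) + Complex.I * cof a x 3 u) := by
  have hσ : (Sig a x : ℂ) ≠ 0 := by exact_mod_cast hx.2.2.1
  simp only [contr_kerr hx, cof_princM hx, Matrix.cons_val]
  field_simp
  ring

theorem contr_conj_princM (hx : x ∈ kerrChart M a) (u : Fin 4 → ℂ) :
    contr (kerr M a) x u (conjVec (princM a x)) = 1 / ((Real.sqrt 2 : ℂ) * zeta a x)
      * (-(Sig a x * cof a x 2 u) - Complex.I * cof a x 3 u) := by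
  have hσ : (Sig a x : ℂ) ≠ 0 := by exact_mod_cast hx.2.2.1
  have hζ := zeta_ne_zero hx
  have hs : (Real.sqrt 2 : ℂ) ≠ 0 := by simp
  simp only [contr_kerr hx, cof_conj_princM hx, Matrix.cons_val]
  field_simp
  ring

theorem isNullTetrad_princ (hx : x ∈ kerrChart M a) :
    IsNullTetrad (kerr M a) x (princL M a x) (princM a x) (princN M a x) := by
  have hσ : (Sig a x : ℂ) ≠ 0 := by exact_mod_cast hx.2.2.1
  have hδ : (Del M a x : ℂ) ≠ 0 := by exact_mod_cast hx.2.2.2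
  have hζ := zeta_ne_zero hx
  have hs : (Real.sqrt 2 : ℂ) ≠ 0 := by simp
  constructor
  · rw [contr_princL hx]
    simp [cof_princL hx]
  · rw [contr_princN hx]
    simp only [cof_princN hx, Matrix.cons_val]
    ring
  · rw [contr_princM hx]
    simp only [cof_princM hx, Matrix.cons_val]
    linear_combination (-(zeta a x / ((Real.sqrt 2 : ℂ) * Sig a x)) ^ 2 * Sig a x) * Complex.I_sq
  · rw [contr_princN hx]
    simp only [cof_princL hx, Matrix.cons_val]
    field_simp
    ring
  · rw [contr_conj_princM hx]
    simp only [cof_princM hx, Matrix.cons_val]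
    field_simp
    rw [ofReal_sqrt_two_sq]
    linear_combination Complex.I_sq
  · rw [contr_princM hx]
    simp [cof_princL hx]
  · rw [contr_princM hx]
    simp [cof_princN hx]

/-! ### Tetrads of the same orientation -/

/-- The Gram matrix of two tuples of vectors. -/
theorem of_mul_map_mul_transpose (g : MetricField) (B T : Fin 4 → Fin 4 → ℂ) (i j : Fin 4) :
    (Matrix.of B * (g x).map Complex.ofReal * (Matrix.of T).transpose) i j
      = contr g x (B i) (T j) := by
  simp only [Matrix.mul_apply, contr, Matrix.map_apply, Matrix.transpose_apply, Finset.sum_mul,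
    Matrix.of_apply]
  rw [Finset.sum_comm]
  refine Finset.sum_congr rfl fun b _ => Finset.sum_congr rfl fun c _ => ?_
  ring

theorem IsNullTetrad.contr_conj {l n : Fin 4 → ℝ} {m : Fin 4 → ℂ} {g : MetricField}
    (h : IsNullTetrad g x l m n) : contr g x (toC l) (conjVec m) = 0 ∧
      contr g x (toC n) (conjVec m) = 0 := by
  constructor
  · rw [← conjVec_toC, ← _root_.KerrLensing.conj_contr, h.l_m, map_zero]
  · rw [← conjVec_toC, ← _root_.KerrLensing.conj_contr, h.n_m, map_zero]

/-- The rows of ℓ and m in the Gram matrix are ±unit vectors, so the determinant collapses to a two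
by two minor. `det_gram_last` is the counterpart for the other pair of rows. -/
theorem det_gram_first {l n : Fin 4 → ℝ} {m : Fin 4 → ℂ} (h : IsNullTetrad (kerr M a) x l m n)
    (u v : Fin 4 → ℂ) :
    (Matrix.of ![toC l, m, u, v] * ((kerr M a) x).map Complex.ofReal *
      (Matrix.of ![toC l, m, conjVec m, toC n]).transpose).det
      = contr (kerr M a) x u (toC l) * contr (kerr M a) x v m
        - contr (kerr M a) x u m * contr (kerr M a) x v (toC l) := by
  have hc := h.contr_conj
  have hnm := (contr_comm (M := M) (a := a) (x := x) m (toC n)).trans h.n_m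
  have hml := (contr_comm (M := M) (a := a) (x := x) m (toC l)).trans h.l_m
  have hG : (Matrix.of ![toC l, m, u, v] * ((kerr M a) x).map Complex.ofReal *
      (Matrix.of ![toC l, m, conjVec m, toC n]).transpose)
      = !![0, 0, 0, 1; 0, 0, -1, 0;
        contr (kerr M a) x u (toC l), contr (kerr M a) x u m, contr (kerr M a) x u (conjVec m),
          contr (kerr M a) x u (toC n);
        contr (kerr M a) x v (toC l), contr (kerr M a) x v m, contr (kerr M a) x v (conjVec m),
          contr (kerr M a) x v (toC n)] := by
    ext i j
    rw [of_mul_map_mul_transpose]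
    fin_cases i <;> fin_cases j <;>
      simp [Matrix.of_apply, h.l_l, h.l_m, h.l_n, hc.1, hnm, hml, h.m_m, h.m_mbar]
  rw [hG, Matrix.det_succ_row_zero]
  simp [Fin.sum_univ_succ, Matrix.det_fin_three, Fin.succAbove]
  ring

theorem det_gram_last {l n : Fin 4 → ℝ} {m : Fin 4 → ℂ} (h : IsNullTetrad (kerr M a) x l m n)
    (u v : Fin 4 → ℂ) :
    (Matrix.of ![u, v, toC l, toC n] * ((kerr M a) x).map Complex.ofReal *
      (Matrix.of ![toC l, m, conjVec m, toC n]).transpose).det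
      = -(contr (kerr M a) x u m * contr (kerr M a) x v (conjVec m)
        - contr (kerr M a) x u (conjVec m) * contr (kerr M a) x v m) := by
  have hc := h.contr_conj
  have hnl := (contr_comm (M := M) (a := a) (x := x) (toC n) (toC l)).trans h.l_n
  have hG : (Matrix.of ![u, v, toC l, toC n] * ((kerr M a) x).map Complex.ofReal *
      (Matrix.of ![toC l, m, conjVec m, toC n]).transpose)
      = !![contr (kerr M a) x u (toC l), contr (kerr M a) x u m, contr (kerr M a) x u (conjVec m),
          contr (kerr M a) x u (toC n);
        contr (kerr M a) x v (toC l), contr (kerr M a) x v m, contr (kerr M a) x v (conjVec m),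
          contr (kerr M a) x v (toC n);
        0, 0, 0, 1; 1, 0, 0, 0] := by
    ext i j
    rw [of_mul_map_mul_transpose]
    fin_cases i <;> fin_cases j <;>
      simp [Matrix.of_apply, h.l_l, h.l_m, h.l_n, hc.1, hc.2, hnl, h.n_m, h.n_n]
  rw [hG, Matrix.det_succ_row_zero]
  simp [Fin.sum_univ_succ, Matrix.det_fin_three, Fin.succAbove]
  ring

/-- If `(ℓ, m, m̄, n)` has the same orientation as the principal null tetrad, then `ℓ ∧ m` is
annihilated by the anti-self-dual combination of the principal two-forms. -/
theorem cofWedge_two_three_eq (hx : x ∈ kerrChart M a) {l n : Fin 4 → ℝ} {m : Fin 4 → ℂ}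
    (h : IsNullTetrad (kerr M a) x l m n)
    (hor : tetradDet l m n = tetradDet (princL M a x) (princM a x) (princN M a x)) :
    cofWedge a x 2 3 (toC l) m = Complex.I * cofWedge a x 0 1 (toC l) m := by
  have hσ : (Sig a x : ℂ) ≠ 0 := by exact_mod_cast hx.2.2.1
  have hδ : (Del M a x : ℂ) ≠ 0 := by exact_mod_cast hx.2.2.2
  have hζ := zeta_ne_zero hx
  have hs : (Real.sqrt 2 : ℂ) ≠ 0 := by simp
  have h1 := det_gram_first h (toC (princL M a x)) (toC (princN M a x))
  have h2 := det_gram_last (isNullTetrad_princ hx) (toC l) m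
  -- Each side factors as det B · det g · det T, and the orientation hypothesis equates the two
  -- values of det T. The two evaluations express e⁰∧e¹ and e²∧e³ on (ℓ, m) through each other.
  have h3 : (Matrix.of ![toC l, m, toC (princL M a x), toC (princN M a x)] *
      ((kerr M a) x).map Complex.ofReal *
      (Matrix.of ![toC l, m, conjVec m, toC n]).transpose).det
      = (Matrix.of ![toC l, m, toC (princL M a x), toC (princN M a x)] *
      ((kerr M a) x).map Complex.ofReal *
      (Matrix.of ![toC (princL M a x), princM a x, conjVec (princM a x),
        toC (princN M a x)]).transpose).det := by
    rw [Matrix.det_mul, Matrix.det_mul _ (Matrix.transpose _), Matrix.det_transpose,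
      Matrix.det_transpose]
    congr 1
  rw [h1, h2, contr_comm _ (toC l), contr_comm _ m, contr_comm _ m, contr_comm _ (toC l)] at h3
  simp only [contr_princL hx, contr_princN hx, contr_princM hx, contr_conj_princM hx] at h3
  have h4 : cofWedge a x 0 1 (toC l) m = -Complex.I * cofWedge a x 2 3 (toC l) m := by
    unfold cofWedge
    field_simp at h3
    rw [ofReal_sqrt_two_sq] at h3
    refine mul_left_cancel₀ (mul_ne_zero (mul_ne_zero (by norm_num : (4 : ℂ) ≠ 0) hσ) hδ) ?_
    linear_combination h3
  rw [h4]
  linear_combination cofWedge a x 2 3 (toC l) m * Complex.I_sq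

theorem kerrPsi2Root_inv (hx : x ∈ kerrChart M a) :
    (kerrPsi2Root M a x)⁻¹ = -(((M ^ (1 / 3 : ℝ) : ℝ) : ℂ)⁻¹ * zeta a x) := by
  have hζ := zeta_ne_zero hx
  rw [kerrPsi2Root, neg_div, inv_neg, inv_div, div_eq_mul_inv, mul_comm]

/-- The Walker-Penrose quantity as a contraction with the principal two-forms. -/
theorem walkerPenrose_eq (hx : x ∈ kerrChart M a) {u v : Fin 4 → ℂ}
    (h : contr (kerr M a) x u v = 0) :
    walkerPenrose M a x u v = -(((M ^ (1 / 3 : ℝ) : ℝ) : ℂ)⁻¹ * (zeta a x *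
      (cofWedge a x 0 1 u v - Complex.I * cofWedge a x 2 3 u v))) := by
  have hσ : (Sig a x : ℂ) ≠ 0 := by exact_mod_cast hx.2.2.1
  have hδ : (Del M a x : ℂ) ≠ 0 := by exact_mod_cast hx.2.2.2
  have hζ := zeta_ne_zero hx
  have hs : (Real.sqrt 2 : ℂ) ≠ 0 := by simp
  rw [contr_kerr hx] at h
  -- The part of the bracket symmetric in u and v is g(u, v) up to a constant factor. Orthogonality
  -- removes it and leaves the wedge products.
  have h1 : 2 * (contr (kerr M a) x u (toC (princL M a x)) * contr (kerr M a) x v (toC (princN M a x))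
      - contr (kerr M a) x u (princM a x) * contr (kerr M a) x v (conjVec (princM a x)))
      = cofWedge a x 0 1 u v - Complex.I * cofWedge a x 2 3 u v := by
    simp only [contr_princL hx, contr_princN hx, contr_princM hx, contr_conj_princM hx, cofWedge]
    field_simp at h ⊢
    rw [ofReal_sqrt_two_sq]
    linear_combination 2 * h + 2 * Del M a x * cof a x 3 u * cof a x 3 v * Complex.I_sq
  rw [walkerPenrose, h1, kerrPsi2Root_inv hx]
  ring

end

section

variable {M a : ℝ} {x : Coord}

/-! ### The Weyl scalars -/

/-- The complex curvature coefficient `M / (r - i a cos θ)³` in real and imaginary part. -/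
theorem div_zeta_cube (hx : x ∈ kerrChart M a) :
    ((M * x 1 * (x 1 ^ 2 - 3 * a ^ 2 * Real.cos (x 2) ^ 2) / Sig a x ^ 3 : ℝ) : ℂ)
      + Complex.I *
        ((M * a * Real.cos (x 2) * (3 * x 1 ^ 2 - a ^ 2 * Real.cos (x 2) ^ 2) / Sig a x ^ 3 : ℝ) : ℂ)
      = M / zeta a x ^ 3 := by
  have hσ : (Sig a x : ℂ) ≠ 0 := by exact_mod_cast hx.2.2.1
  have hζ := zeta_ne_zero hx
  have h := zeta_mul_conj (a := a) (x := x)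
  -- Since ζ times its conjugate is Σ, 1/ζ³ is the cube of the conjugate over Σ³.
  have h2 : ((x 1 : ℂ) + Complex.I * a * (Real.cos (x 2) : ℂ)) ^ 3
      = x 1 * (x 1 ^ 2 - 3 * a ^ 2 * (Real.cos (x 2) : ℂ) ^ 2)
        + Complex.I * (a * (Real.cos (x 2) : ℂ)
          * (3 * x 1 ^ 2 - a ^ 2 * (Real.cos (x 2) : ℂ) ^ 2)) := by
    linear_combination (3 * (x 1 : ℂ) * a ^ 2 * (Real.cos (x 2) : ℂ) ^ 2
      + a ^ 3 * (Real.cos (x 2) : ℂ) ^ 3 * Complex.I) * Complex.I_sq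
  rw [eq_div_iff (pow_ne_zero 3 hζ)]
  push_cast at h h2 ⊢
  field_simp
  rw [← h]
  linear_combination -(M : ℂ) * zeta a x ^ 3 * h2

theorem kerrPsi2_eq (hx : x ∈ kerrChart M a) : kerrPsi2 M a x = -(M / zeta a x ^ 3) := by
  have hσ : (Sig a x : ℂ) ≠ 0 := by exact_mod_cast hx.2.2.1
  have hδ : (Del M a x : ℂ) ≠ 0 := by exact_mod_cast hx.2.2.2
  have hζ := zeta_ne_zero hx
  have hs : (Real.sqrt 2 : ℂ) ≠ 0 := by simp
  have hT := isNullTetrad_princ hx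
  have hc := hT.contr_conj
  have hmn := (contr_comm (M := M) (a := a) (x := x) (princM a x) (toC (princN M a x))).trans hT.n_m
  rw [kerrPsi2, psi2, weylContr_kerr hx, ← div_zeta_cube hx, hc.1, hT.l_n, hT.m_mbar, hmn]
  generalize ((M * x 1 * (x 1 ^ 2 - 3 * a ^ 2 * Real.cos (x 2) ^ 2) / Sig a x ^ 3 : ℝ) : ℂ) = X
  generalize
    ((M * a * Real.cos (x 2) * (3 * x 1 ^ 2 - a ^ 2 * Real.cos (x 2) ^ 2) / Sig a x ^ 3 : ℝ) : ℂ) = Y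
  simp only [cofWedge, cof_princL hx, cof_princM hx, cof_princN hx, cof_conj_princM hx,
    Matrix.cons_val]
  field_simp
  rw [ofReal_sqrt_two_sq]
  ring

theorem kerrPsi2Root_cube (hM : 0 < M) (hx : x ∈ kerrChart M a) :
    kerrPsi2Root M a x ^ 3 = kerrPsi2 M a x := by
  have h : ((M ^ (1 / 3 : ℝ) : ℝ) : ℂ) ^ 3 = M := by
    rw [← Complex.ofReal_pow, ← Real.rpow_natCast, ← Real.rpow_mul hM.le]
    norm_num
  rw [kerrPsi2_eq hx, kerrPsi2Root, div_pow, Odd.neg_pow (by decide), h, neg_div]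

theorem kerrPsi2_ne_zero (hM : 0 < M) (hx : x ∈ kerrChart M a) : kerrPsi2 M a x ≠ 0 := by
  rw [kerrPsi2_eq hx]
  exact neg_ne_zero.2 (div_ne_zero (by exact_mod_cast hM.ne') (pow_ne_zero 3 (zeta_ne_zero hx)))

/-- With W = (e⁰∧e¹)(ℓ,m) and (e²∧e³)(ℓ,m) = iW, the real and imaginary coefficients X, Y of M/ζ³
contribute -6XW² and -6iYW². -/
theorem psi0_eq (hx : x ∈ kerrChart M a) {l n : Fin 4 → ℝ} {m : Fin 4 → ℂ}
    (h : IsNullTetrad (kerr M a) x l m n)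
    (hor : tetradDet l m n = tetradDet (princL M a x) (princM a x) (princN M a x)) :
    psi0 (kerr M a) x (toC l) m
      = -(6 * M * cofWedge a x 0 1 (toC l) m ^ 2 / zeta a x ^ 3) := by
  have h1 := cofWedge_two_three_eq hx h hor
  -- The Plücker relation of the simple bivector ℓ∧m; it eliminates the mixed products.
  have h2 : cofWedge a x 0 1 (toC l) m * cofWedge a x 2 3 (toC l) m
      - cofWedge a x 0 2 (toC l) m * cofWedge a x 1 3 (toC l) m
      + cofWedge a x 0 3 (toC l) m * cofWedge a x 1 2 (toC l) m = 0 := by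
    unfold cofWedge
    ring
  have h3 : -(6 * M * cofWedge a x 0 1 (toC l) m ^ 2 / zeta a x ^ 3)
      = -6 * cofWedge a x 0 1 (toC l) m ^ 2 * (M / zeta a x ^ 3) := by ring
  rw [psi0, weylContr_kerr hx, h3, ← div_zeta_cube hx, h.l_l, h.l_m]
  generalize ((M * x 1 * (x 1 ^ 2 - 3 * a ^ 2 * Real.cos (x 2) ^ 2) / Sig a x ^ 3 : ℝ) : ℂ) = X
  generalize
    ((M * a * Real.cos (x 2) * (3 * x 1 ^ 2 - a ^ 2 * Real.cos (x 2) ^ 2) / Sig a x ^ 3 : ℝ) : ℂ) = Y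
  rw [h1] at h2 ⊢
  linear_combination 2 * Y * h2 + 3 * X * cofWedge a x 0 1 (toC l) m ^ 2 * Complex.I_sq

theorem psi0_eq_walkerPenrose (hM : 0 < M) (hx : x ∈ kerrChart M a) {l n : Fin 4 → ℝ}
    {m : Fin 4 → ℂ} (h : IsNullTetrad (kerr M a) x l m n)
    (hor : tetradDet l m n = tetradDet (princL M a x) (princM a x) (princN M a x)) :
    psi0 (kerr M a) x (toC l) m
      = -(3 * ((M ^ (5 / 3 : ℝ) : ℝ) : ℂ) * walkerPenrose M a x (toC l) m ^ 2)
          / (2 * zeta a x ^ 5) := by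
  have hζ := zeta_ne_zero hx
  have hc : ((M ^ (1 / 3 : ℝ) : ℝ) : ℂ) ≠ 0 := by
    exact_mod_cast (Real.rpow_pos_of_pos hM _).ne'
  have h5 : ((M ^ (5 / 3 : ℝ) : ℝ) : ℂ) = M * ((M ^ (1 / 3 : ℝ) : ℝ) : ℂ) ^ 2 := by
    rw [← Complex.ofReal_pow, ← Complex.ofReal_mul, ← Real.rpow_natCast, ← Real.rpow_mul hM.le]
    nth_rw 2 [← Real.rpow_one M]
    rw [← Real.rpow_add hM]
    norm_num
  rw [psi0_eq hx h hor, walkerPenrose_eq hx h.l_m, cofWedge_two_three_eq hx h hor, h5]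
  have hI : cofWedge a x 0 1 (toC l) m
      - Complex.I * (Complex.I * cofWedge a x 0 1 (toC l) m)
      = 2 * cofWedge a x 0 1 (toC l) m := by
    linear_combination -cofWedge a x 0 1 (toC l) m * Complex.I_sq
  rw [hI]
  field_simp
  ring

end

section

variable {M a : ℝ}

/-! ### Conservation of the Walker-Penrose quantity -/

theorem hasDerivWithinAt_ckyRe {I : Set ℝ} {r t : ℝ → ℝ} {r' t' s : ℝ}
    (hr : HasDerivWithinAt r r' I s) (ht : HasDerivWithinAt t t' I s) (i j : Fin 4) :
    HasDerivWithinAt (fun u => ckyRe a (r u) (Real.sin (t u)) (Real.cos (t u)) i j)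
      (r' * ckyReDR a (r s) (Real.sin (t s)) (Real.cos (t s)) i j
        + t' * ckyReDT a (r s) (Real.sin (t s)) (Real.cos (t s)) i j) I s := by
  have hS := ht.sin
  have hC := ht.cos
  fin_cases i <;> fin_cases j <;> simp only [ckyRe, ckyReDR, ckyReDT, Fin.reduceFinMk,
    Fin.zero_eta, Fin.mk_one, Matrix.of_apply, Matrix.cons_val]
  all_goals
    apply HasDerivWithinAt.congr_deriv
    case h =>
      repeat' first
        | exact hasDerivWithinAt_const _ _ _ | assumption
        | with_reducible apply HasDerivWithinAt.fun_neg
        | with_reducible apply HasDerivWithinAt.fun_add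
        | with_reducible apply HasDerivWithinAt.fun_mul
        | with_reducible apply HasDerivWithinAt.fun_pow
    case h' => ring

theorem hasDerivWithinAt_ckyIm {I : Set ℝ} {r t : ℝ → ℝ} {r' t' s : ℝ}
    (hr : HasDerivWithinAt r r' I s) (ht : HasDerivWithinAt t t' I s) (i j : Fin 4) :
    HasDerivWithinAt (fun u => ckyIm a (r u) (Real.sin (t u)) (Real.cos (t u)) i j)
      (r' * ckyImDR a (r s) (Real.sin (t s)) i j
        + t' * ckyImDT a (r s) (Real.sin (t s)) (Real.cos (t s)) i j) I s := by
  have hS := ht.sin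
  have hC := ht.cos
  fin_cases i <;> fin_cases j <;> simp only [ckyIm, ckyImDR, ckyImDT, Fin.reduceFinMk,
    Fin.zero_eta, Fin.mk_one, Matrix.of_apply, Matrix.cons_val]
  all_goals
    apply HasDerivWithinAt.congr_deriv
    case h =>
      repeat' first
        | exact hasDerivWithinAt_const _ _ _ | assumption
        | with_reducible apply HasDerivWithinAt.fun_neg
        | with_reducible apply HasDerivWithinAt.fun_add
        | with_reducible apply HasDerivWithinAt.fun_mul
        | with_reducible apply HasDerivWithinAt.fun_pow
    case h' => ring

/-- Leibniz rule: the Christoffel terms from transporting ℓ and m are exactly those that complete ∂h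
to ∇h. -/
theorem sum_covDeriv_eq (G D : Fin 4 → Fin 4 → Fin 4 → ℂ) (h : Fin 4 → Fin 4 → ℂ)
    (l m : Fin 4 → ℂ) :
    ∑ i, ∑ j, (((∑ k, l k * D k i j) * l i + h i j * -∑ b, ∑ c, G i b c * l b * l c) * m j
        + h i j * l i * -∑ b, ∑ c, G j b c * l b * m c)
      = ∑ k, ∑ i, ∑ j, (D k i j - ∑ d, (G d k i * h d j + G d k j * h i d))
        * l k * l i * m j := by
  have h1 : ∑ i, ∑ j, (∑ k, l k * D k i j) * l i * m j
      = ∑ k, ∑ i, ∑ j, D k i j * l k * l i * m j := by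
    simp only [Finset.sum_mul]
    rw [Finset.sum_congr rfl fun i _ => Finset.sum_comm, Finset.sum_comm]
    refine Finset.sum_congr rfl fun k _ => Finset.sum_congr rfl fun i _ =>
      Finset.sum_congr rfl fun j _ => ?_
    ring
  have h2 : ∑ d, ∑ j, h d j * (∑ k, ∑ i, G d k i * l k * l i) * m j
      = ∑ k, ∑ i, ∑ j, (∑ d, G d k i * h d j) * l k * l i * m j := by
    simp only [Finset.sum_mul, Finset.mul_sum]
    rw [Finset.sum_comm, Finset.sum_congr rfl fun j _ => Finset.sum_comm, Finset.sum_comm,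
      Finset.sum_congr rfl fun k _ => Finset.sum_congr rfl fun j _ => Finset.sum_comm,
      Finset.sum_congr rfl fun k _ => Finset.sum_comm]
    refine Finset.sum_congr rfl fun k _ => Finset.sum_congr rfl fun i _ =>
      Finset.sum_congr rfl fun j _ => Finset.sum_congr rfl fun d _ => ?_
    ring
  have h3 : ∑ i, ∑ d, h i d * l i * (∑ k, ∑ j, G d k j * l k * m j)
      = ∑ k, ∑ i, ∑ j, (∑ d, G d k j * h i d) * l k * l i * m j := by
    simp only [Finset.sum_mul, Finset.mul_sum]
    rw [Finset.sum_congr rfl fun i _ => Finset.sum_comm, Finset.sum_comm,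
      Finset.sum_congr rfl fun k _ => Finset.sum_congr rfl fun i _ => Finset.sum_comm]
    refine Finset.sum_congr rfl fun k _ => Finset.sum_congr rfl fun i _ =>
      Finset.sum_congr rfl fun j _ => Finset.sum_congr rfl fun d _ => ?_
    ring
  simp only [Finset.sum_add_distrib, sub_mul, add_mul, Finset.sum_sub_distrib, mul_neg, neg_mul,
    Finset.sum_neg_distrib, h1, h2, h3]
  ring

/-- The derivative of `h_{ij} ℓ^i m^j` along a geodesic with tangent `ℓ`, for parallel `m`, is the
contraction of the covariant derivative of `h`. -/
theorem hasDerivWithinAt_contraction {I : Set ℝ} {γ : ℝ → Coord} {l : ℝ → Fin 4 → ℝ}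
    {m : ℝ → Fin 4 → ℂ} {s : ℝ} (hs : s ∈ I) (hγ : γ s ∈ kerrChart M a)
    (hl : IsParallelAlong (kerr M a) I γ l (fun s => toC (l s)))
    (hm : IsParallelAlong (kerr M a) I γ l m)
    {h : ℝ → Matrix (Fin 4) (Fin 4) ℝ} {D : Fin 4 → Fin 4 → Fin 4 → ℝ}
    (hh : ∀ i j, HasDerivWithinAt (fun u => h u i j) (∑ k, l s k * D k i j) I s) :
    HasDerivWithinAt (fun u => ∑ i, ∑ j, (h u i j : ℂ) * (l u i : ℂ) * m u j)
      (∑ k, ∑ i, ∑ j, (covDeriv M a (γ s 1) (Real.sin (γ s 2)) (Real.cos (γ s 2)) (Sig a (γ s))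
        (Del M a (γ s)) (h s) D k i j : ℂ) * (l s k : ℂ) * (l s i : ℂ) * m s j) I s := by
  have h1 := hasDerivWithinAt_pi.1 (hl.2 s hs)
  have h2 := hasDerivWithinAt_pi.1 (hm.2 s hs)
  have h3 := HasDerivWithinAt.fun_sum (u := Finset.univ) fun i _ =>
    HasDerivWithinAt.fun_sum (u := Finset.univ) fun j _ =>
      ((hh i j).ofReal_comp.fun_mul (h1 i)).fun_mul (h2 j)
  refine h3.congr_deriv ?_
  simp only [christoffel_kerr hγ, toC, covDeriv, kerrChris]
  push_cast
  exact sum_covDeriv_eq _ _ _ _ _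

end

section

variable {M a : ℝ}

/-- Contraction with ℓ^k ℓ^i sees only the part symmetric in k and i, and the Killing-Yano equations
control exactly that part. -/
theorem two_mul_sum_symm (T : Fin 4 → Fin 4 → Fin 4 → ℂ) (l m : Fin 4 → ℂ) :
    2 * ∑ k, ∑ i, ∑ j, T k i j * l k * l i * m j
      = ∑ k, ∑ i, ∑ j, (T k i j + T i k j) * l k * l i * m j := by
  have h : ∑ k, ∑ i, ∑ j, T i k j * l k * l i * m j = ∑ k, ∑ i, ∑ j, T k i j * l k * l i * m j := by
    rw [Finset.sum_comm]
    refine Finset.sum_congr rfl fun k _ => Finset.sum_congr rfl fun i _ =>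
      Finset.sum_congr rfl fun j _ => ?_
    ring
  simp only [add_mul, Finset.sum_add_distrib, h]
  ring

/-- The conformal Killing equation, contracted with a null vector `ℓ` and a vector orthogonal to
`ℓ`. -/
theorem sum_conformal_killing (g : Fin 4 → Fin 4 → ℂ) (ξ l m : Fin 4 → ℂ)
    (hll : ∑ i, ∑ j, g i j * l i * l j = 0) (hlm : ∑ i, ∑ j, g i j * l i * m j = 0) :
    ∑ k, ∑ i, ∑ j, (2 * (g k i * ξ j) - g k j * ξ i - g i j * ξ k) * l k * l i * m j = 0 := by
  have h1 : ∑ k, ∑ i, ∑ j, 2 * (g k i * ξ j) * l k * l i * m j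
      = (∑ k, ∑ i, g k i * l k * l i) * (∑ j, 2 * ξ j * m j) := by
    simp only [Finset.sum_mul]
    simp only [Finset.mul_sum]
    refine Finset.sum_congr rfl fun k _ => Finset.sum_congr rfl fun i _ =>
      Finset.sum_congr rfl fun j _ => ?_
    ring
  have h2 : ∑ k, ∑ i, ∑ j, g k j * ξ i * l k * l i * m j
      = (∑ k, ∑ j, g k j * l k * m j) * (∑ i, ξ i * l i) := by
    simp only [Finset.sum_mul]
    simp only [Finset.mul_sum]
    refine Finset.sum_congr rfl fun k _ => ?_
    rw [Finset.sum_comm]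
    refine Finset.sum_congr rfl fun i _ => Finset.sum_congr rfl fun j _ => ?_
    ring
  have h3 : ∑ k, ∑ i, ∑ j, g i j * ξ k * l k * l i * m j
      = (∑ k, ξ k * l k) * (∑ i, ∑ j, g i j * l i * m j) := by
    simp only [Finset.sum_mul]
    simp only [Finset.mul_sum]
    refine Finset.sum_congr rfl fun k _ => Finset.sum_congr rfl fun i _ =>
      Finset.sum_congr rfl fun j _ => ?_
    ring
  simp only [sub_mul, Finset.sum_sub_distrib, h1, h2, h3, hll, hlm]
  ring

section Along

variable {I : Set ℝ} {γ : ℝ → Coord} {l : ℝ → Fin 4 → ℝ} {m : ℝ → Fin 4 → ℂ} {s : ℝ}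

theorem hasDerivWithinAt_ckyRe_contraction (hs : s ∈ I) (hγ : γ s ∈ kerrChart M a)
    (hl : IsParallelAlong (kerr M a) I γ l (fun s => toC (l s)))
    (hm : IsParallelAlong (kerr M a) I γ l m)
    (hll : contr (kerr M a) (γ s) (toC (l s)) (toC (l s)) = 0)
    (hlm : contr (kerr M a) (γ s) (toC (l s)) (m s) = 0) :
    HasDerivWithinAt (fun u => ∑ i, ∑ j, (ckyRe a (γ u 1) (Real.sin (γ u 2)) (Real.cos (γ u 2)) i j
      : ℂ) * (l u i : ℂ) * m u j) 0 I s := by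
  have h0 := hasDerivWithinAt_pi.1 (hl.1 s hs)
  refine (hasDerivWithinAt_contraction hs hγ hl hm (D := ckyReD a (γ s 1) (Real.sin (γ s 2))
    (Real.cos (γ s 2))) fun i j => (hasDerivWithinAt_ckyRe (h0 1) (h0 2) i j).congr_deriv ?_).congr_deriv
    ?_
  · simp [ckyReD, Fin.sum_univ_four]
  · refine mul_left_cancel₀ (two_ne_zero (α := ℂ)) ?_
    have h := two_mul_sum_symm (fun k i j => (covDeriv M a (γ s 1) (Real.sin (γ s 2))
      (Real.cos (γ s 2)) (Sig a (γ s)) (Del M a (γ s)) (ckyRe a (γ s 1) (Real.sin (γ s 2))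
      (Real.cos (γ s 2))) (ckyReD a (γ s 1) (Real.sin (γ s 2)) (Real.cos (γ s 2))) k i j : ℂ))
      (toC (l s)) (m s)
    refine h.trans ?_
    simp only [← Complex.ofReal_add, covDeriv_ckyRe (σ := Sig a (γ s)) (δ := Del M a (γ s)) rfl rfl
      (Real.cos_sq' _) hγ.2.2.1 hγ.2.2.2 (sin_ne_zero_of_mem_kerrChart hγ)]
    push_cast
    rw [mul_zero]
    exact sum_conformal_killing (fun i j => (kerr M a (γ s) i j : ℂ))
      (fun j => (kerr M a (γ s) 0 j : ℂ)) _ _ hll hlm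

/-- As there are no trace terms, neither nullity of ℓ nor orthogonality to m enters. -/
theorem hasDerivWithinAt_ckyIm_contraction (hs : s ∈ I) (hγ : γ s ∈ kerrChart M a)
    (hl : IsParallelAlong (kerr M a) I γ l (fun s => toC (l s)))
    (hm : IsParallelAlong (kerr M a) I γ l m) :
    HasDerivWithinAt (fun u => ∑ i, ∑ j, (ckyIm a (γ u 1) (Real.sin (γ u 2)) (Real.cos (γ u 2)) i j
      : ℂ) * (l u i : ℂ) * m u j) 0 I s := by
  have h0 := hasDerivWithinAt_pi.1 (hl.1 s hs)
  refine (hasDerivWithinAt_contraction hs hγ hl hm (D := ckyImD a (γ s 1) (Real.sin (γ s 2))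
    (Real.cos (γ s 2))) fun i j => (hasDerivWithinAt_ckyIm (h0 1) (h0 2) i j).congr_deriv ?_).congr_deriv
    ?_
  · simp [ckyImD, Fin.sum_univ_four]
  · refine mul_left_cancel₀ (two_ne_zero (α := ℂ)) ?_
    have h := two_mul_sum_symm (fun k i j => (covDeriv M a (γ s 1) (Real.sin (γ s 2))
      (Real.cos (γ s 2)) (Sig a (γ s)) (Del M a (γ s)) (ckyIm a (γ s 1) (Real.sin (γ s 2))
      (Real.cos (γ s 2))) (ckyImD a (γ s 1) (Real.sin (γ s 2)) (Real.cos (γ s 2))) k i j : ℂ))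
      (toC (l s)) (m s)
    refine h.trans ?_
    simp only [← Complex.ofReal_add, covDeriv_ckyIm (σ := Sig a (γ s)) (δ := Del M a (γ s)) rfl rfl
      (Real.cos_sq' _) hγ.2.2.1 hγ.2.2.2 (sin_ne_zero_of_mem_kerrChart hγ)]
    simp

end Along

/-- The Walker-Penrose quantity in terms of the conformal Killing-Yano tensor. -/
theorem walkerPenrose_eq_cky {x : Coord} (hx : x ∈ kerrChart M a) {u v : Fin 4 → ℂ}
    (h : contr (kerr M a) x u v = 0) :
    walkerPenrose M a x u v = -(((M ^ (1 / 3 : ℝ) : ℝ) : ℂ)⁻¹ *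
      (∑ i, ∑ j, (ckyRe a (x 1) (Real.sin (x 2)) (Real.cos (x 2)) i j : ℂ) * u i * v j
        - Complex.I *
          ∑ i, ∑ j, (ckyIm a (x 1) (Real.sin (x 2)) (Real.cos (x 2)) i j : ℂ) * u i * v j)) := by
  rw [walkerPenrose_eq hx h, ← sum_wedge, ← sum_wedge, zeta]
  congr 2
  simp only [Finset.mul_sum, ← Finset.sum_sub_distrib]
  refine Finset.sum_congr rfl fun i _ => Finset.sum_congr rfl fun j _ => ?_
  rw [ckyRe_eq, ckyIm_eq]
  push_cast
  linear_combination (a : ℂ) * Complex.cos (x 2) * wedge a (x 1) (Real.sin (x 2)) 2 3 i j * u i * v j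
    * Complex.I_sq

/-- The Walker-Penrose quantity of a parallel vector orthogonal to a null geodesic is constant. -/
theorem walkerPenrose_const {I : Set ℝ} (hI : I.OrdConnected) {γ : ℝ → Coord}
    (hγ : ∀ s ∈ I, γ s ∈ kerrChart M a) {l n : ℝ → Fin 4 → ℝ} {m : ℝ → Fin 4 → ℂ}
    (hT : IsAdaptedTetrad (kerr M a) I γ l m n) {s t : ℝ} (hs : s ∈ I) (ht : t ∈ I) :
    walkerPenrose M a (γ s) (toC (l s)) (m s) = walkerPenrose M a (γ t) (toC (l t)) (m t) := by
  have h := fun u (hu : u ∈ I) => (hasDerivWithinAt_ckyRe_contraction hu (hγ u hu) hT.geodesic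
    hT.parallel_m (hT.tetrad u hu).l_l (hT.tetrad u hu).l_m).fun_sub
    ((hasDerivWithinAt_ckyIm_contraction hu (hγ u hu) hT.geodesic hT.parallel_m).const_mul
      Complex.I)
  -- The mean value inequality with bound 0 on a convex set; it accepts derivatives within I, hence
  -- end points.
  have h2 := Convex.norm_image_sub_le_of_norm_hasDerivWithin_le (C := 0) h (by simp) hI.convex ht hs
  rw [zero_mul, norm_le_zero_iff, sub_eq_zero] at h2
  rw [walkerPenrose_eq_cky (hγ s hs) (hT.tetrad s hs).l_m,
    walkerPenrose_eq_cky (hγ t ht) (hT.tetrad t ht).l_m]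
  exact congrArg (fun z => -(((M ^ (1 / 3 : ℝ) : ℝ) : ℂ)⁻¹ * z)) h2

end

end KerrLensing

end

theorem corollary2 (M a : ℝ) (hM : 0 < M)
    (I : Set ℝ) (hI : I.OrdConnected)
    (γ : ℝ → KerrLensing.Coord) (hγ : ∀ s ∈ I, γ s ∈ KerrLensing.kerrChart M a)
    (l : ℝ → Fin 4 → ℝ) (m : ℝ → Fin 4 → ℂ) (n : ℝ → Fin 4 → ℝ)
    (hT : KerrLensing.IsAdaptedTetrad (KerrLensing.kerr M a) I γ l m n)
    (hor : ∀ s ∈ I, KerrLensing.tetradDet (l s) (m s) (n s)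
      = KerrLensing.tetradDet (KerrLensing.princL M a (γ s)) (KerrLensing.princM a (γ s))
          (KerrLensing.princN M a (γ s))) :
    (∀ x ∈ KerrLensing.kerrChart M a,
      KerrLensing.kerrPsi2Root M a x ^ 3 = KerrLensing.kerrPsi2 M a x ∧
      KerrLensing.kerrPsi2 M a x ≠ 0) ∧
    ∃ K : ℂ, ∀ s ∈ I,
      KerrLensing.walkerPenrose M a (γ s) (KerrLensing.toC (l s)) (m s) = K ∧
      KerrLensing.psi0 (KerrLensing.kerr M a) (γ s) (KerrLensing.toC (l s)) (m s)
        = -(3 * ((M ^ (5 / 3 : ℝ) : ℝ) : ℂ) * K ^ 2)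
          / (2 * ((γ s 1 : ℂ) - Complex.I * (a : ℂ) * (Real.cos (γ s 2) : ℂ)) ^ 5) := by
  refine ⟨fun x hx => ⟨KerrLensing.kerrPsi2Root_cube hM hx, KerrLensing.kerrPsi2_ne_zero hM hx⟩, ?_⟩
  -- The constant is the value at some point of I; if I is empty, any number serves.
  rcases I.eq_empty_or_nonempty with rfl | ⟨t, ht⟩
  · exact ⟨0, fun s hs => hs.elim⟩
  · refine ⟨KerrLensing.walkerPenrose M a (γ t) (KerrLensing.toC (l t)) (m t), fun s hs => ?_⟩
    have h := KerrLensing.walkerPenrose_const hI hγ hT hs ht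
    exact ⟨h, h ▸ KerrLensing.psi0_eq_walkerPenrose hM (hγ s hs) (hT.tetrad s hs) (hor s hs)⟩
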